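/- Let $F$ be a free group of finite rank. An $F$-basis is a free-generating set of $F$; for a subset $X$ of $F$ put $X^{-1} := \{x^{-1} : x \in X\}$ and $X^{\pm 1} := X \cup X^{-1}$. A word in $F$ is either a straight word (an element of $F$) or a cyclic word (a conjugacy class of $F$). For an $F$-basis $X$, an $X^{\pm1}$-sequence is a finite sequence of elements of $X^{\pm 1}$; it is reduced if no entry is immediately followed by its inverse, and cyclically reduced if the sequence repeated twice is reduced. The $X$-length of a straight word $g$ is the length of the unique reduced $X^{\pm1}$-sequence with product $g$; the $X$-length of a cyclic word $c$ is the common length of the cyclically reduced $X^{\pm1}$-sequences with product in $c$. Let $R$ be a finite set of words in $F$, and set $h(X) := \sum_{r \in R} X\text{-length}(r)$ for each $F$-basis $X$. An $F$-basis $Y$ is a Whitehead transform of an $F$-basis $X$ if $Y \subseteq \{1,x\}\cdot X\cdot\{1,x^{-1}\}$ for some $x \in X^{\pm1}$. An $F$-basis $X$ is a local-minimum point for $h$ if $h(X) \le h(X')$ for each Whitehead transform $X'$ of $X$. Let $X$ and $Y$ be $F$-bases. For $V \subseteq F$, let $X \rightarrowtail V$ be the graph with vertex set $V$ and an edge from $v$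 to $xv$ for all $x \in X$ and $v \in V$ with $xv \in V$; let $V \leftarrowtail Y$ be the graph with vertex set $V$ and an edge from $v$ to $vy$ for all $y \in Y$ and $v \in V$ with $vy \in V$. The set $V$ is an $(X,Y)$-translator if $1 \in V$, $V$ generates $F$, and both of these graphs are trees. In that case let $V_{\ge 3}$ be the set of those $v \in V - \{1\}$ for which the sum of the valences of $v$ in the two graphs is at least $3$. Let $\kappa$ be the minimum of $|V - \{1\}|$ over all $(X,Y)$-translators $V$. If $\kappa > \operatorname{rank}(F)$, put $d(X,Y) := \kappa$; otherwise let $d(X,Y)$ be the minimum of $|V_{\ge 3}|$ over all $(X,Y)$-translators $V$ of cardinality $1 + \operatorname{rank}(F)$. Theorem (Whitehead). If the $F$-bases $X$ and $Y$ are both local-minimum points for $h$, then $d(X,Y)$ is finite, and either $X^{\pm1} = Y^{\pm1}$ or there is a Whitehead transform $Y'$ of $Y$ such that $h(Y') = h(Y)$ and $d(X,Y') < d(X,Y)$. -/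

import Mathlib

open scoped Pointwise

noncomputable section

namespace WhiteheadGraph

variable {F : Type*} [Group F]

/-- `X` is an `F`-basis, that is, a free-generating set of `F`: the canonical homomorphism from the
free group on the set `X` to `F` is an isomorphism. -/
def IsBasis (X : Set F) : Prop :=
  Function.Bijective (FreeGroup.lift (fun x : X => (x : F)))

/-- The set `X^{±1} = X ∪ X⁻¹` (here `X⁻¹` is the set of inverses of elements of `X`). -/
def symm (X : Set F) : Set F := X ∪ X⁻¹

/-! ### Words, lengths, and the function `h` -/

/-- A word in `F`: either a straight word, which is an element of `F`, or a cyclic word, which is a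
conjugacy class of elements of `F`. -/
inductive Word (F : Type*) [Group F] where
  | straight (g : F) : Word F
  | cyclic (c : ConjClasses F) : Word F

/-- A reduced `X^{±1}`-sequence: a finite sequence of elements of `X^{±1}` in which no element is
immediately followed by its inverse. -/
def IsReducedSeq (X : Set F) (σ : List F) : Prop :=
  (∀ a ∈ σ, a ∈ symm X) ∧ σ.IsChain (fun a b => b ≠ a⁻¹)

/-- A cyclically reduced `X^{±1}`-sequence: its repetition `σ, σ` is reduced. -/
def IsCyclicallyReducedSeq (X : Set F) (σ : List F) : Prop :=
  IsReducedSeq X (σ ++ σ)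

/-- The `X`-length of a word. For a straight word `g` it is the length of the reduced
`X^{±1}`-sequence with product `g`. For a cyclic word `c` it is the length of a cyclically reduced
`X^{±1}`-sequence with product in `c`. If `X` is a basis then the first sequence exists and is
unique, and the second exists and is unique up to cyclic permutation, so that each of the two sets
of natural numbers below has exactly one element. -/
def Word.length (X : Set F) : Word F → ℕ
  | .straight g => sInf {n | ∃ σ : List F, IsReducedSeq X σ ∧ σ.prod = g ∧ σ.length = n}
  | .cyclic c =>
      sInf {n | ∃ σ : List F, IsCyclicallyReducedSeq X σ ∧ ConjClasses.mk σ.prod = c ∧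
        σ.length = n}

/-- The total `X`-length `h(X)` of the finite set `R` of words. -/
def h (R : Finset (Word F)) (X : Set F) : ℕ := ∑ r ∈ R, r.length X

/-- The basis `Y` is a Whitehead transform of the basis `X`: there is `x ∈ X^{±1}` with
`Y ⊆ {1, x} · X · {1, x⁻¹}`. -/
def IsWhiteheadTransform (X Y : Set F) : Prop :=
  ∃ x ∈ symm X, Y ⊆ ({1, x} : Set F) * X * ({1, x⁻¹} : Set F)

/-- The basis `X` is a local-minimum point for `h`: `h(X) ≤ h(X')` for each basis `X'` that is a
Whitehead transform of `X`. -/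
def IsLocalMin (R : Finset (Word F)) (X : Set F) : Prop :=
  ∀ X' : Set F, IsBasis X' → IsWhiteheadTransform X X' → h R X ≤ h R X'

/-! ### Gersten's graphs

If `X` is a basis then `v ≠ x * v` for `x ∈ X`, and two elements of `F` are joined by at most one
`X`-edge. So the graph with vertex set `F` and an edge from `v` to `x * v` for each `v ∈ F` and
each `x ∈ X` is (up to orientation) a simple graph, and likewise for the edges from `v` to
`v * y`, `y ∈ Y`. -/

/-- The left Cayley graph of `F` with respect to `X`: an edge joins `v` and `x * v` for each
`v ∈ F` and each `x ∈ X`. -/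
def leftCayley (X : Set F) : SimpleGraph F :=
  SimpleGraph.fromRel (fun v w => ∃ x ∈ X, x * v = w)

/-- The right Cayley graph of `F` with respect to `Y`: an edge joins `v` and `v * y` for each
`v ∈ F` and each `y ∈ Y`. -/
def rightCayley (Y : Set F) : SimpleGraph F := SimpleGraph.mulCayley Y

/-- `V` is an `(X, Y)`-translator: `V` contains `1`, it generates `F`, and the full subgraphs with
vertex set `V` of the left Cayley graph for `X` and of the right Cayley graph for `Y` are trees. -/
structure IsTranslator (X Y V : Set F) : Prop where
  one_mem : (1 : F) ∈ V
  generates : Subgroup.closure V = ⊤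
  left_tree : ((leftCayley X).induce V).IsTree
  right_tree : ((rightCayley Y).induce V).IsTree

/-- The valence of `v` in the amalgam, over the common vertex set `V`, of the full subgraphs on `V`
of the left Cayley graph for `X` and of the right Cayley graph for `Y`. The edge set of the amalgam
is the disjoint union of the two edge sets (an `X`-edge and a `Y`-edge with the same ends are
different), so that the two valences are added. -/
def valence (X Y V : Set F) (v : F) : ℕ∞ :=
  {w ∈ V | (leftCayley X).Adj v w}.encard + {w ∈ V | (rightCayley Y).Adj v w}.encard

/-- The set of elements of `V - {1}` of valence at least three. -/
def branchSet (X Y V : Set F) : Set F := {v ∈ V \ {1} | 3 ≤ valence X Y V v}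

/-- The minimum of `|V - {1}|` over all `(X, Y)`-translators `V`. -/
def kappa (X Y : Set F) : ℕ∞ :=
  ⨅ (V : Set F) (_ : IsTranslator X Y V), (V \ {1}).encard

open Classical in
/-- The translator complexity `d(X, Y)`. The rank of `F` is the cardinality of its basis `X`. If
`kappa X Y` exceeds the rank, then `d(X, Y)` is `kappa X Y`. Otherwise it is the minimum number of
elements of `V - {1}` of valence at least three, over all `(X, Y)`-translators `V` of cardinality
`1 + rank F`. The values are in `ℕ∞`, in which an infimum over an empty family is `⊤`. -/
def d (X Y : Set F) : ℕ∞ :=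
  if X.encard < kappa X Y then kappa X Y
  else ⨅ (V : Set F) (_ : IsTranslator X Y V) (_ : V.encard = 1 + X.encard),
    (branchSet X Y V).encard

end WhiteheadGraph

end

open scoped Pointwise
noncomputable section
namespace WhiteheadGraph
variable {F : Type*} [Group F] {X Y : Set F}

/-! ### Reduced sequences and normal forms -/

/-! The tree conditions become convexity conditions (`isTranslator_iff`): `V` is convex in the tree
of `Y`, and `V⁻¹` in the tree of `X`. Inversion therefore exchanges the two bases, and every
statement has a dual. A finite translator exists (`exists_finite_translator`), which makes `d`
finite.

In a translator, each word of `R` is carried by a closed walk with at most as many `X`-steps as its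
`X`-length and at most as many `Y`-steps as its `Y`-length (`IsTranslator.exists_realizes`). The
weight of an edge is the number of times these walks traverse it.

Surgery deletes an `X`-edge of `V` and multiplies the part of `V` not containing 1 by a letter `b`
of `Y^{±1}`. The walks then spell the words of `R` in a Whitehead transform `Y'`. Each traversal of
the deleted edge costs at most one letter, and each traversal of a `b`-edge across the cut saves
one: `h(Y')` plus the crossing weight is at most `h(Y)` plus the deleted weight
(`Surgery.h_add_le`). At a local minimum the crossing weight is thus at most the deleted weight, and
equality of the two gives `h(Y') = h(Y)`.

If `kappa` exceeds the rank, some label occurs on two edges of a smallest translator. Edges of one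
label form a tree for the other basis, and a leaf of that tree is an edge on a single square.
Surgery along such an innermost `X`-edge yields an innermost `Y`-edge that is no heavier
(`Inner.next`), and dually. Started at a lightest innermost `X`-edge, this returns to an equal
weight, so `h` is unchanged while the surgery identifies two vertices
(`IsTranslator.exists_smaller`).

If `kappa` does not exceed the rank, a smallest translator has one edge of each label. Without
branch vertices both trees are stars centred at 1, and `X^{±1} = Y^{±1}` (`IsTranslator.symm_eq`).
Otherwise take a `Y`-edge from a branch vertex to 1 or to another branch vertex, and an `X`-edge
exchangeable with it (`IsTranslator.exists_exchange`). Surgery and its dual make the two weights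
equal, and the surgery merges the ends of the `Y`-edge, which removes a branch vertex
(`IsTranslator.exists_fewer_branches`). -/

lemma mem_symm {a : F} : a ∈ symm Y ↔ a ∈ Y ∨ a⁻¹ ∈ Y := Iff.rfl

lemma inv_mem_symm {a : F} (h : a ∈ symm Y) : a⁻¹ ∈ symm Y := by
  rcases h with h | h
  · exact Or.inr (by simpa using h)
  · exact Or.inl h

/-- The letter of `Y^{±1}` that corresponds to a letter of the free group on `Y`. -/
def letter (p : Y × Bool) : F := cond p.2 (p.1 : F) (p.1 : F)⁻¹

lemma mem_range_letter {a : F} : a ∈ Set.range (letter : Y × Bool → F) ↔ a ∈ symm Y := by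
  constructor
  · rintro ⟨⟨y, b⟩, rfl⟩
    cases b
    · exact Or.inr (by simp [letter])
    · exact Or.inl (by simp [letter])
  · rintro (h | h)
    · exact ⟨(⟨a, h⟩, true), rfl⟩
    · exact ⟨(⟨a⁻¹, h⟩, false), by simp [letter]⟩

lemma lift_mk_eq (L : List (Y × Bool)) :
    FreeGroup.lift (fun x : Y => (x : F)) (FreeGroup.mk L) = (L.map letter).prod := by
  rw [FreeGroup.lift_mk]; rfl

lemma IsBasis.eq_nil_of_prod_eq_one (hY : IsBasis Y) {L : List (Y × Bool)}
    (hL : FreeGroup.IsReduced L) (h : (L.map letter).prod = 1) : L = [] := by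
  rw [← lift_mk_eq, ← map_one (FreeGroup.lift fun x : Y => (x : F))] at h
  classical
  have h1 := congrArg FreeGroup.toWord (hY.1 h)
  rwa [FreeGroup.toWord_mk, hL.reduce_eq, FreeGroup.toWord_one] at h1

lemma IsBasis.inv_notMem (hY : IsBasis Y) {y : F} (h : y ∈ Y) : y⁻¹ ∉ Y := by
  intro h'
  have := hY.eq_nil_of_prod_eq_one (L := [(⟨y, h⟩, true), (⟨y⁻¹, h'⟩, true)])
    (by simp [FreeGroup.IsReduced]) (by simp [letter])
  simp at this

lemma IsBasis.inv_ne (hY : IsBasis Y) {y : F} (h : y ∈ symm Y) : y⁻¹ ≠ y := by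
  intro h'
  rcases h with h | h
  · exact hY.inv_notMem h (h'.symm ▸ h)
  · have h2 : y⁻¹ ∈ Y := h
    exact hY.inv_notMem h2 (by rw [inv_inv]; rwa [h'] at h2)

lemma IsReducedSeq.nil : IsReducedSeq Y [] := ⟨by simp, by simp⟩

lemma isReducedSeq_singleton {a : F} (h : a ∈ symm Y) : IsReducedSeq Y [a] := ⟨by simpa, by simp⟩

lemma isReducedSeq_cons {a : F} {l : List F} :
    IsReducedSeq Y (a :: l) ↔ a ∈ symm Y ∧ (∀ b ∈ l.head?, b ≠ a⁻¹) ∧ IsReducedSeq Y l := by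
  simp only [IsReducedSeq, List.isChain_cons, List.forall_mem_cons]
  tauto

lemma isReducedSeq_cons_cons {a b : F} {l : List F} :
    IsReducedSeq Y (a :: b :: l) ↔ a ∈ symm Y ∧ b ≠ a⁻¹ ∧ IsReducedSeq Y (b :: l) := by
  rw [isReducedSeq_cons]; simp

lemma isReducedSeq_append {l m : List F} :
    IsReducedSeq Y (l ++ m) ↔ IsReducedSeq Y l ∧ IsReducedSeq Y m ∧
      ∀ a ∈ l.getLast?, ∀ b ∈ m.head?, b ≠ a⁻¹ := by
  simp only [IsReducedSeq, List.isChain_append, List.forall_mem_append]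
  tauto

lemma IsReducedSeq.tail {a : F} {l : List F} (h : IsReducedSeq Y (a :: l)) : IsReducedSeq Y l :=
  (isReducedSeq_cons.1 h).2.2

lemma IsReducedSeq.mem_symm {a : F} {l : List F} (h : IsReducedSeq Y (a :: l)) : a ∈ symm Y :=
  (isReducedSeq_cons.1 h).1

lemma IsReducedSeq.inv {l : List F} (h : IsReducedSeq Y l) :
    IsReducedSeq Y (l.map (·⁻¹)).reverse := by
  refine ⟨fun a ha => ?_, ?_⟩
  · simp only [List.mem_reverse, List.mem_map] at ha
    obtain ⟨b, hb, rfl⟩ := ha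
    exact inv_mem_symm (h.1 b hb)
  · rw [List.isChain_reverse, List.isChain_map]
    refine h.2.imp fun a b hab => ?_
    intro h'
    exact hab (by rw [h']; simp)

lemma prod_map_inv_reverse (l : List F) : (l.map (·⁻¹)).reverse.prod = l.prod⁻¹ := by
  rw [List.prod_inv_reverse]

lemma IsBasis.exists_list (hY : IsBasis Y) (g : F) :
    ∃ l : List F, (∀ a ∈ l, a ∈ symm Y) ∧ l.prod = g := by
  obtain ⟨w, hw⟩ := hY.2 g
  classical
  refine ⟨w.toWord.map letter, fun a ha => ?_, ?_⟩
  · obtain ⟨p, -, rfl⟩ := List.mem_map.1 ha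
    exact mem_range_letter.1 ⟨p, rfl⟩
  · rw [← lift_mk_eq, FreeGroup.mk_toWord, hw]

lemma IsBasis.closure_eq_top (hY : IsBasis Y) : Subgroup.closure Y = ⊤ := by
  rw [eq_top_iff]
  rintro g -
  obtain ⟨l, hl, rfl⟩ := hY.exists_list g
  refine Subgroup.list_prod_mem _ fun a ha => ?_
  rcases hl a ha with h | h
  · exact Subgroup.subset_closure h
  · rw [← inv_inv a]; exact inv_mem (Subgroup.subset_closure h)

lemma IsBasis.eq_nil (hY : IsBasis Y) {l : List F} (h : IsReducedSeq Y l) (h1 : l.prod = 1) :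
    l = [] := by
  have : l ∈ Set.range (List.map (letter : Y × Bool → F)) := by
    rw [Set.range_list_map]
    exact fun a ha => mem_range_letter.2 (h.1 a ha)
  obtain ⟨L, rfl⟩ := this
  rw [hY.eq_nil_of_prod_eq_one (L := L) ?_ h1, List.map_nil]
  have h2 := h.2
  rw [List.isChain_map] at h2
  refine h2.imp fun a b hab h3 => ?_
  obtain ⟨a, s⟩ := a
  obtain ⟨b, t⟩ := b
  obtain rfl : a = b := h3
  by_contra h4
  apply hab
  cases s <;> cases t <;> simp_all [letter]

lemma IsBasis.one_notMem_symm (hY : IsBasis Y) : (1 : F) ∉ symm Y := fun h => by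
  simpa using hY.eq_nil (isReducedSeq_singleton h) (by simp)

/-- If the first letters differ, the inverse of one sequence followed by the other is reduced with
product 1, hence empty. -/
lemma IsBasis.reduced_unique (hY : IsBasis Y) {l m : List F} (hl : IsReducedSeq Y l)
    (hm : IsReducedSeq Y m) (h : l.prod = m.prod) : l = m := by
  induction l generalizing m with
  | nil => exact (hY.eq_nil hm (by simpa using h.symm)).symm
  | cons a l ih =>
    cases m with
    | nil => exact hY.eq_nil hl (by simpa using h)
    | cons b m =>
      by_cases hab : a = b
      · subst hab
        rw [ih hl.tail hm.tail (by simpa using h)]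
      · have h1 : IsReducedSeq Y (((a :: l).map (·⁻¹)).reverse ++ b :: m) := by
          refine isReducedSeq_append.2 ⟨hl.inv, hm, ?_⟩
          simp only [List.map_cons, List.reverse_cons, List.getLast?_append, List.getLast?_singleton,
            List.head?_cons, Option.mem_def, Option.some_or, Option.some.injEq]
          rintro _ rfl _ rfl
          rw [inv_inv]
          exact Ne.symm hab
        have h2 := hY.eq_nil h1 (by rw [List.prod_append, prod_map_inv_reverse, h, inv_mul_cancel])
        simp at h2

/-- A sequence of letters can be reduced, without becoming longer. -/
lemma exists_reduced_of_list {l : List F} (hl : ∀ a ∈ l, a ∈ symm Y) :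
    ∃ m, IsReducedSeq Y m ∧ m.prod = l.prod ∧ m.length ≤ l.length := by
  induction l with
  | nil => exact ⟨[], .nil, rfl, le_rfl⟩
  | cons a l ih =>
    obtain ⟨m, hm, hp, hlen⟩ := ih fun b hb => hl b (List.mem_cons_of_mem _ hb)
    cases m with
    | nil =>
      exact ⟨[a], isReducedSeq_singleton (hl a (by simp)), by simpa using hp.symm, by simp⟩
    | cons b m =>
      by_cases hab : b = a⁻¹
      · refine ⟨m, hm.tail, ?_, ?_⟩
        · rw [List.prod_cons, ← hp, hab]; simp
        · simp at hlen ⊢; omega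
      · exact ⟨a :: b :: m, isReducedSeq_cons_cons.2 ⟨hl a (by simp), hab, hm⟩,
          by rw [List.prod_cons, hp, List.prod_cons], by simpa using hlen⟩

lemma IsBasis.exists_reduced (hY : IsBasis Y) (g : F) : ∃ l, IsReducedSeq Y l ∧ l.prod = g := by
  obtain ⟨l, hl, rfl⟩ := hY.exists_list g
  obtain ⟨m, hm, h, -⟩ := exists_reduced_of_list hl
  exact ⟨m, hm, h⟩

/-- The reduced `Y^{±1}`-sequence with product `g`. -/
def nf (Y : Set F) (g : F) : List F := Classical.epsilon fun l => IsReducedSeq Y l ∧ l.prod = g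

lemma IsBasis.nf_reduced (hY : IsBasis Y) (g : F) : IsReducedSeq Y (nf Y g) :=
  (Classical.epsilon_spec (hY.exists_reduced g)).1

lemma IsBasis.nf_prod (hY : IsBasis Y) (g : F) : (nf Y g).prod = g :=
  (Classical.epsilon_spec (hY.exists_reduced g)).2

lemma IsBasis.nf_eq (hY : IsBasis Y) {l : List F} (hl : IsReducedSeq Y l) : nf Y l.prod = l :=
  hY.reduced_unique (hY.nf_reduced _) hl (hY.nf_prod _)

lemma IsBasis.nf_one (hY : IsBasis Y) : nf Y (1 : F) = [] := hY.nf_eq .nil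

lemma IsBasis.nf_inv (hY : IsBasis Y) (g : F) : nf Y g⁻¹ = ((nf Y g).map (·⁻¹)).reverse := by
  conv_lhs => rw [← hY.nf_prod g, ← prod_map_inv_reverse]
  exact hY.nf_eq (hY.nf_reduced g).inv

/-! ### Half-spaces and convex sets -/

/-- The elements whose reduced sequence begins with `y`. -/
def side (Y : Set F) (y : F) : Set F := {g | (nf Y g).head? = some y}

lemma IsBasis.mem_side_of_reduced (hY : IsBasis Y) {y : F} {l : List F} (h : IsReducedSeq Y l) :
    l.prod ∈ side Y y ↔ l.head? = some y := by
  rw [side, Set.mem_ofPred_eq, hY.nf_eq h]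

lemma IsBasis.cons_mem_side (hY : IsBasis Y) {y : F} {l : List F} (h : IsReducedSeq Y (y :: l)) :
    (y :: l).prod ∈ side Y y := by
  rw [hY.mem_side_of_reduced h]; rfl

lemma IsBasis.exists_of_mem_side (hY : IsBasis Y) {y g : F} (h : g ∈ side Y y) :
    ∃ l, IsReducedSeq Y (y :: l) ∧ g = (y :: l).prod := by
  have h1 := hY.nf_reduced g
  have h2 := hY.nf_prod g
  obtain ⟨l, hl⟩ := List.head?_eq_some_iff.1 h
  rw [hl] at h1 h2
  exact ⟨l, h1, h2.symm⟩

lemma IsBasis.one_notMem_side (hY : IsBasis Y) {y : F} : (1 : F) ∉ side Y y := by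
  rw [side, Set.mem_ofPred_eq, hY.nf_one]; simp

lemma IsBasis.self_mem_side (hY : IsBasis Y) {y : F} (hy : y ∈ symm Y) : y ∈ side Y y := by
  simpa using hY.cons_mem_side (isReducedSeq_singleton hy)

lemma IsBasis.exists_mem_side (hY : IsBasis Y) {g : F} (hg : g ≠ 1) :
    ∃ y ∈ symm Y, g ∈ side Y y := by
  have h1 := hY.nf_reduced g
  have h2 := hY.nf_prod g
  cases h : nf Y g with
  | nil => rw [h] at h2; exact absurd h2.symm hg
  | cons y l => exact ⟨y, h1.1 y (by simp [h]), by simp [side, h]⟩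

lemma side_disjoint {y z g : F} (h : g ∈ side Y y) (h' : g ∈ side Y z) : y = z := by
  rw [side, Set.mem_ofPred_eq] at h h'
  rw [h] at h'
  exact Option.some.inj h'

/-- Multiplication on the right by a letter leaves a half-space only along its boundary edge. -/
lemma IsBasis.side_leave (hY : IsBasis Y) {y z g : F} (hz : z ∈ symm Y) (h : g ∈ side Y y)
    (h' : g * z ∉ side Y y) : g = y ∧ z = y⁻¹ := by
  obtain ⟨l, hl, rfl⟩ := hY.exists_of_mem_side h
  by_cases hlast : ∀ a ∈ (y :: l).getLast?, z ≠ a⁻¹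
  · refine absurd ?_ h'
    have hr : IsReducedSeq Y ((y :: l) ++ [z]) :=
      isReducedSeq_append.2 ⟨hl, isReducedSeq_singleton hz, fun a ha b hb => by
        simp at hb; subst hb; exact hlast a ha⟩
    have : (y :: l).prod * z = ((y :: l) ++ [z]).prod := by simp [mul_assoc]
    rw [this]
    exact hY.cons_mem_side hr
  · push Not at hlast
    obtain ⟨a, ha, rfl⟩ := hlast
    rcases List.eq_nil_or_concat l with rfl | ⟨l', c, rfl⟩
    · simp at ha; subst ha; simp
    · simp only [List.concat_eq_append] at *
      have hc : c = a := by simpa [List.getLast?_cons] using ha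
      subst hc
      rw [← List.cons_append] at hl
      refine absurd ?_ h'
      have : (y :: (l' ++ [c])).prod * c⁻¹ = (y :: l').prod := by simp [mul_assoc]
      rw [this]
      exact hY.cons_mem_side (isReducedSeq_append.1 hl).1

lemma IsBasis.side_enter (hY : IsBasis Y) {y z g : F} (hz : z ∈ symm Y) (h : g ∉ side Y y)
    (h' : g * z ∈ side Y y) : g = 1 ∧ z = y := by
  obtain ⟨h1, h2⟩ := hY.side_leave (inv_mem_symm hz) h' (by simpa using h)
  have h3 : z = y := inv_injective h2
  exact ⟨by simpa [h3] using h1, h3⟩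

/-- The edge from 1 to `y` cuts the tree into two half-spaces, and translation by `y⁻¹` turns the
one containing 1 into the half-space of `y⁻¹`. -/
lemma IsBasis.side_compl (hY : IsBasis Y) {y g : F} (hy : y ∈ symm Y) :
    g ∉ side Y y ↔ y⁻¹ * g ∈ side Y y⁻¹ := by
  constructor
  · intro h
    have h1 := hY.nf_reduced g
    have h2 : IsReducedSeq Y (y⁻¹ :: nf Y g) :=
      isReducedSeq_cons.2 ⟨inv_mem_symm hy, fun b hb hb' => h (by rw [inv_inv] at hb'; exact hb' ▸ hb),
        h1⟩
    have := hY.cons_mem_side h2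
    rwa [List.prod_cons, hY.nf_prod] at this
  · intro h h'
    obtain ⟨l, hl, rfl⟩ := hY.exists_of_mem_side h'
    rw [List.prod_cons, inv_mul_cancel_left, hY.mem_side_of_reduced hl.tail] at h
    exact (isReducedSeq_cons.1 hl).2.1 _ h rfl

/-- A set is `Y`-convex if it contains, with two elements, the first vertex of the reduced
`Y`-path from one to the other. -/
def Conv (Y C : Set F) : Prop :=
  ∀ v ∈ C, ∀ y l, IsReducedSeq Y (y :: l) → v * (y :: l).prod ∈ C → v * y ∈ C

lemma Conv.inter {C D : Set F} (hC : Conv Y C) (hD : Conv Y D) : Conv Y (C ∩ D) :=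
  fun v hv y l h h' => ⟨hC v hv.1 y l h h'.1, hD v hv.2 y l h h'.2⟩

lemma Conv.preimage_mul {C : Set F} (hC : Conv Y C) (g : F) : Conv Y {v | g * v ∈ C} := by
  intro v hv y l h h'
  simp only [Set.mem_ofPred_eq, ← mul_assoc] at *
  exact hC _ hv y l h h'

lemma IsBasis.conv_side (hY : IsBasis Y) (y : F) : Conv Y (side Y y) := by
  intro v hv z l h h'
  by_contra h2
  obtain ⟨rfl, rfl⟩ := hY.side_leave h.mem_symm hv h2
  rw [List.prod_cons, mul_inv_cancel_left, hY.mem_side_of_reduced h.tail] at h'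
  exact (isReducedSeq_cons.1 h).2.1 _ h' (by simp)

lemma IsBasis.conv_compl_side (hY : IsBasis Y) (y : F) : Conv Y (side Y y)ᶜ := by
  intro v hv z l h h' h2
  obtain ⟨rfl, rfl⟩ := hY.side_enter h.mem_symm hv h2
  rw [one_mul] at h'
  exact h' (hY.cons_mem_side h)

/-- A convex set with points on both sides of an edge contains the edge. -/
lemma IsBasis.edge_mem (hY : IsBasis Y) {C : Set F} (hC : Conv Y C) {v y p q : F}
    (hp : p ∈ C) (hq : q ∈ C) (hps : v⁻¹ * p ∉ side Y y) (hqs : v⁻¹ * q ∈ side Y y) :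
    v ∈ C ∧ v * y ∈ C := by
  obtain ⟨l, hl, hlp⟩ := hY.exists_reduced (p⁻¹ * q)
  induction l generalizing p with
  | nil =>
    rw [List.prod_nil, eq_comm, inv_mul_eq_one] at hlp
    exact absurd (hlp ▸ hqs) hps
  | cons z l ih =>
    have hpz : p * z ∈ C := hC p hp z l hl (by rw [hlp]; simpa)
    by_cases h : v⁻¹ * (p * z) ∈ side Y y
    · rw [← mul_assoc] at h
      obtain ⟨h1, h2⟩ := hY.side_enter hl.mem_symm hps h
      rw [inv_mul_eq_one] at h1
      subst h1 h2
      exact ⟨hp, hpz⟩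
    · refine ih hpz h hl.tail ?_
      rw [List.prod_cons] at hlp
      rw [mul_inv_rev, mul_assoc, ← hlp, inv_mul_cancel_left]

/-! ### Connectedness and the translator conditions -/

/-- The elements `u` and `w` are joined by a `Y`-path with all vertices in `V`. -/
def Linked (Y V : Set F) : F → F → Prop :=
  Relation.ReflTransGen fun u w => u ∈ V ∧ w ∈ V ∧ u⁻¹ * w ∈ symm Y

lemma Linked.symm {V : Set F} {u w : F} (h : Linked Y V u w) : Linked Y V w u := by
  induction h with
  | refl => exact .refl
  | tail _ h ih =>
    refine Relation.ReflTransGen.head ⟨h.2.1, h.1, ?_⟩ ih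
    simpa using inv_mem_symm h.2.2

lemma Linked.trans {V : Set F} {u v w : F} (h : Linked Y V u v) (h' : Linked Y V v w) :
    Linked Y V u w := Relation.ReflTransGen.trans h h'

lemma Linked.mono {V W : Set F} (hVW : V ⊆ W) {u w : F} (h : Linked Y V u w) : Linked Y W u w :=
  Relation.ReflTransGen.mono (fun _ _ h => ⟨hVW h.1, hVW h.2.1, h.2.2⟩) _ _ h

lemma Linked.single {V : Set F} {u z : F} (hu : u ∈ V) (hz : z ∈ WhiteheadGraph.symm Y)
    (h : u * z ∈ V) : Linked Y V u (u * z) :=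
  Relation.ReflTransGen.single ⟨hu, h, by simpa⟩

/-- Every two elements of `V` are joined by a `Y`-path in `V`. -/
def IsConn (Y V : Set F) : Prop := ∀ u ∈ V, ∀ w ∈ V, Linked Y V u w

lemma IsConn.of_center {V : Set F} (c : F) (h : ∀ u ∈ V, Linked Y V c u) : IsConn Y V :=
  fun u hu w hw => (h u hu).symm.trans (h w hw)

lemma IsConn.union {V W : Set F} (hV : IsConn Y V) (hW : IsConn Y W) {c : F} (hc : c ∈ V)
    (hc' : c ∈ W) : IsConn Y (V ∪ W) := by
  refine .of_center c ?_
  rintro u (hu | hu)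
  · exact (hV c hc u hu).mono Set.subset_union_left
  · exact (hW c hc' u hu).mono Set.subset_union_right

lemma IsBasis.isConn (hY : IsBasis Y) {V : Set F} (hV : Conv Y V) : IsConn Y V := by
  intro u hu w hw
  obtain ⟨l, hl, hlp⟩ := hY.exists_reduced (u⁻¹ * w)
  induction l generalizing u with
  | nil =>
    rw [List.prod_nil, eq_comm, inv_mul_eq_one] at hlp
    exact hlp ▸ .refl
  | cons z l ih =>
    have huz : u * z ∈ V := hV u hu z l hl (by rw [hlp]; simpa)
    refine (Linked.single hu hl.mem_symm huz).trans (ih _ huz hl.tail ?_)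
    rw [List.prod_cons] at hlp
    rw [mul_inv_rev, mul_assoc, ← hlp, inv_mul_cancel_left]

/-- Any path from `v` to a point beyond the edge from `v` to `v * y` must enter that half-space, and
by `side_enter` it can do so only along this edge. -/
lemma IsBasis.conv (hY : IsBasis Y) {V : Set F} (hV : IsConn Y V) : Conv Y V := by
  intro v hv y l hl hvl
  have h : ∀ p, Linked Y V p (v * (y :: l).prod) → v⁻¹ * p ∉ side Y y → v * y ∈ V := by
    intro p hp
    induction hp using Relation.ReflTransGen.head_induction_on with
    | refl => intro h'; rw [inv_mul_cancel_left] at h'; exact absurd (hY.cons_mem_side hl) h'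
    | @head p q hpq _ ih =>
      intro hps
      by_cases hqs : v⁻¹ * q ∈ side Y y
      · have h2 : v⁻¹ * q = v⁻¹ * p * (p⁻¹ * q) := by group
        obtain ⟨h3, h4⟩ := hY.side_enter hpq.2.2 hps (h2 ▸ hqs)
        rw [h3, one_mul] at h2
        rw [← h4, ← h2, mul_inv_cancel_left]
        exact hpq.2.1
      · exact ih hqs
  exact h v (hV v hv _ hvl) (by rw [inv_mul_cancel]; exact hY.one_notMem_side)

/-! ### Induced trees in the Cayley graphs as convex sets -/

lemma IsBasis.rightCayley_adj (hY : IsBasis Y) {u w : F} :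
    (rightCayley Y).Adj u w ↔ u⁻¹ * w ∈ symm Y := by
  rw [rightCayley, SimpleGraph.mulCayley_adj, mem_symm]
  simp only [mul_inv_rev, inv_inv, and_iff_right_iff_imp]
  rintro h rfl
  simp only [inv_mul_cancel, or_self] at h
  exact hY.one_notMem_symm (Or.inl h)

lemma IsBasis.leftCayley_adj (hX : IsBasis X) {u w : F} :
    (leftCayley X).Adj u w ↔ (rightCayley X).Adj u⁻¹ w⁻¹ := by
  rw [hX.rightCayley_adj, leftCayley, SimpleGraph.fromRel_adj, mem_symm]
  constructor
  · rintro ⟨-, ⟨x, hx, rfl⟩ | ⟨x, hx, rfl⟩⟩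
    · exact Or.inr (by simpa)
    · exact Or.inl (by simpa)
  · intro h
    refine ⟨?_, ?_⟩
    · rintro rfl
      simp only [inv_inv, mul_inv_cancel, inv_one, or_self] at h
      exact hX.one_notMem_symm (Or.inl h)
    · rcases h with h | h
      · exact Or.inr ⟨_, h, by simp⟩
      · exact Or.inl ⟨_, h, by simp⟩

/-- Every edge is a bridge, being the only way into the half-space behind it. -/
lemma IsBasis.rightCayley_isAcyclic (hY : IsBasis Y) : (rightCayley Y).IsAcyclic := by
  rw [SimpleGraph.isAcyclic_iff_forall_adj_isBridge]
  intro v w hvw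
  rw [SimpleGraph.isBridge_iff, SimpleGraph.reachable_iff_reflTransGen]
  intro h
  rw [hY.rightCayley_adj] at hvw
  have key : ∀ p, Relation.ReflTransGen
      ((rightCayley Y).deleteEdges {s(v, w)}).Adj v p →
      v⁻¹ * p ∉ side Y (v⁻¹ * w) := by
    intro p hp
    induction hp with
    | refl => rw [inv_mul_cancel]; exact hY.one_notMem_side
    | @tail p q _ hpq ih =>
      intro hq
      rw [SimpleGraph.deleteEdges_adj, hY.rightCayley_adj] at hpq
      have h2 : v⁻¹ * q = v⁻¹ * p * (p⁻¹ * q) := by group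
      obtain ⟨h3, h4⟩ := hY.side_enter hpq.1 ih (h2 ▸ hq)
      rw [inv_mul_eq_one] at h3
      subst h3
      rw [mul_right_inj] at h4
      subst h4
      exact hpq.2 rfl
  exact key w h (hY.self_mem_side hvw)

lemma reachable_induce {α : Type*} {G : SimpleGraph α} {V : Set α} {r : α → α → Prop}
    (hr : ∀ u w, r u w ↔ u ∈ V ∧ w ∈ V ∧ G.Adj u w) (u w : V) :
    (G.induce V).Reachable u w ↔ Relation.ReflTransGen r u w := by
  rw [SimpleGraph.reachable_iff_reflTransGen]
  constructor
  · intro h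
    exact h.lift (fun v : V => (v : α)) fun a b hab => (hr _ _).2 ⟨a.2, b.2, hab⟩
  · intro h
    obtain ⟨w, hw⟩ := w
    change Relation.ReflTransGen r u w at h
    induction h with
    | refl => exact .refl
    | tail _ h ih =>
      obtain ⟨h1, h2, h3⟩ := (hr _ _).1 h
      exact (ih h1).tail h3

lemma IsBasis.right_isTree_iff (hY : IsBasis Y) {V : Set F} (h1 : V.Nonempty) :
    ((rightCayley Y).induce V).IsTree ↔ Conv Y V := by
  have hr : ∀ u w : V, ((rightCayley Y).induce V).Reachable u w ↔ Linked Y V u w :=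
    reachable_induce fun u w => by rw [hY.rightCayley_adj]
  constructor
  · exact fun h => hY.conv fun u hu w hw => (hr ⟨u, hu⟩ ⟨w, hw⟩).1 (h.connected ⟨u, hu⟩ ⟨w, hw⟩)
  · intro h
    have := h1.to_subtype
    exact ⟨⟨fun u w => (hr u w).2 (hY.isConn h u u.2 w w.2)⟩, hY.rightCayley_isAcyclic.induce V⟩

/-- Inversion carries the left Cayley graph on `V` to the right Cayley graph on `V⁻¹`. -/
def IsBasis.invIso (hX : IsBasis X) (V : Set F) :
    (leftCayley X).induce V ≃g (rightCayley X).induce V⁻¹ where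
  toFun v := ⟨v⁻¹, by simp⟩
  invFun v := ⟨v⁻¹, v.2⟩
  left_inv v := by simp
  right_inv v := by simp
  map_rel_iff' := by
    intro a b
    exact hX.leftCayley_adj.symm

lemma IsBasis.left_isTree_iff (hX : IsBasis X) {V : Set F} (h1 : V.Nonempty) :
    ((leftCayley X).induce V).IsTree ↔ Conv X V⁻¹ := by
  rw [(hX.invIso V).isTree_iff, hX.right_isTree_iff h1.inv]

lemma isTranslator_iff (hX : IsBasis X) (hY : IsBasis Y) {V : Set F} :
    IsTranslator X Y V ↔ 1 ∈ V ∧ Subgroup.closure V = ⊤ ∧ Conv X V⁻¹ ∧ Conv Y V := by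
  constructor
  · rintro ⟨h1, h2, h3, h4⟩
    exact ⟨h1, h2, (hX.left_isTree_iff ⟨1, h1⟩).1 h3, (hY.right_isTree_iff ⟨1, h1⟩).1 h4⟩
  · rintro ⟨h1, h2, h3, h4⟩
    exact ⟨h1, h2, (hX.left_isTree_iff ⟨1, h1⟩).2 h3, (hY.right_isTree_iff ⟨1, h1⟩).2 h4⟩

lemma IsTranslator.inv (hX : IsBasis X) (hY : IsBasis Y) {V : Set F} (h : IsTranslator X Y V) :
    IsTranslator Y X V⁻¹ := by
  rw [isTranslator_iff hX hY] at h
  rw [isTranslator_iff hY hX]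
  refine ⟨by simpa using h.1, ?_, by simpa using h.2.2.2, h.2.2.1⟩
  rw [Subgroup.closure_inv, h.2.1]

/-! ### Finiteness of bases -/

/-- The exponent sum of `y` is a homomorphism to `ℤ` that kills the other basis elements. -/
lemma IsBasis.notMem_closure (hY : IsBasis Y) {y : F} (hy : y ∈ Y) :
    y ∉ Subgroup.closure (Y \ {y}) := by
  classical
  let e := MulEquiv.ofBijective _ hY
  let f : FreeGroup Y →* Multiplicative ℤ :=
    FreeGroup.lift fun z => if (z : F) = y then Multiplicative.ofAdd 1 else 1
  have he : ∀ z : Y, e.symm z = FreeGroup.of z := fun z => by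
    rw [MulEquiv.symm_apply_eq]; exact FreeGroup.lift_apply_of.symm
  have h1 : Subgroup.closure (Y \ {y}) ≤ (f.comp e.symm.toMonoidHom).ker := by
    rw [Subgroup.closure_le]
    rintro z ⟨hz, hzy⟩
    have := he ⟨z, hz⟩
    simp only [SetLike.mem_coe, MonoidHom.mem_ker, MonoidHom.comp_apply, MulEquiv.coe_toMonoidHom]
    rw [this, FreeGroup.lift_apply_of]
    exact if_neg hzy
  intro h
  have h3 := h1 h
  have := he ⟨y, hy⟩
  simp only [MonoidHom.mem_ker, MonoidHom.comp_apply, MulEquiv.coe_toMonoidHom] at h3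
  rw [this, FreeGroup.lift_apply_of, if_pos rfl] at h3
  exact absurd (Multiplicative.ofAdd.injective h3) one_ne_zero

/-- Only finitely many letters occur in the normal forms of a finite generating set; any further
basis element would be a product of the others. -/
lemma IsBasis.finite [Group.FG F] (hY : IsBasis Y) : Y.Finite := by
  obtain ⟨S, hS, hfin⟩ := (Group.fg_iff (G := F)).1 ‹_›
  let T : Set F := ⋃ s ∈ S, {a | a ∈ nf Y s ∨ a⁻¹ ∈ nf Y s}
  have hT : T.Finite := by
    refine hfin.biUnion fun s _ => ?_
    have h1 : {a | a ∈ nf Y s}.Finite := (nf Y s).finite_toSet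
    exact h1.union (h1.preimage inv_injective.injOn)
  refine hT.subset fun y hy => ?_
  by_contra hyT
  suffices h : Subgroup.closure S ≤ Subgroup.closure (Y \ {y}) from
    hY.notMem_closure hy (h (by rw [hS]; trivial))
  rw [Subgroup.closure_le]
  intro s hs
  rw [SetLike.mem_coe]
  rw [← hY.nf_prod s]
  refine Subgroup.list_prod_mem _ fun a ha => ?_
  have hy' : ∀ b, (b ∈ nf Y s ∨ b⁻¹ ∈ nf Y s) → b ≠ y := by
    rintro b hb rfl
    exact hyT (Set.mem_biUnion hs hb)
  rcases (hY.nf_reduced s).1 a ha with h | h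
  · exact Subgroup.subset_closure ⟨h, hy' a (Or.inl ha)⟩
  · rw [← inv_inv a]
    exact inv_mem (Subgroup.subset_closure ⟨h, hy' _ (Or.inr (by simpa))⟩)

lemma IsBasis.encard_eq (hX : IsBasis X) (hY : IsBasis Y) : X.encard = Y.encard := by
  have e : FreeGroup X ≃* FreeGroup Y :=
    (MulEquiv.ofBijective _ hX).trans (MulEquiv.ofBijective _ hY).symm
  exact Set.encard_congr (Equiv.ofFreeGroupEquiv e)

/-! ### Existence of finite translators -/

/-- With different first letters, nothing cancels between `g⁻¹` and `k`. -/
lemma IsBasis.nf_inv_mul (hY : IsBasis Y) {g k : F} (h : ∀ y, g ∈ side Y y → k ∉ side Y y) :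
    nf Y (g⁻¹ * k) = nf Y g⁻¹ ++ nf Y k := by
  have hr : IsReducedSeq Y (nf Y g⁻¹ ++ nf Y k) := by
    refine isReducedSeq_append.2 ⟨hY.nf_reduced _, hY.nf_reduced _, ?_⟩
    rintro a ha b hb rfl
    refine h a⁻¹ ?_ hb
    rw [hY.nf_inv, List.getLast?_reverse, List.head?_map, Option.mem_def, Option.map_eq_some_iff]
      at ha
    obtain ⟨c, hc, rfl⟩ := ha
    rw [inv_inv]
    exact hc
  rw [← hY.nf_eq hr, List.prod_append, hY.nf_prod, hY.nf_prod]

lemma IsBasis.conv_of_prefix (hY : IsBasis Y) {V : Set F}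
    (h : ∀ l m, IsReducedSeq Y (l ++ m) → (l ++ m).prod ∈ V → l.prod ∈ V) : Conv Y V := by
  refine hY.conv (.of_center 1 ?_)
  have : ∀ l, IsReducedSeq Y l → l.prod ∈ V → Linked Y V 1 l.prod := by
    intro l
    induction l using List.reverseRecOn with
    | nil => exact fun _ _ => .refl
    | append_singleton l a ih =>
      intro hl hlV
      have hV := h l [a] hl hlV
      obtain ⟨h1, h2, -⟩ := isReducedSeq_append.1 hl
      rw [List.prod_append, List.prod_singleton] at hlV ⊢
      exact (ih h1 hV).trans (.single hV h2.mem_symm hlV)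
  intro u hu
  have h1 := this _ (hY.nf_reduced u)
  rw [hY.nf_prod] at h1
  exact h1 hu

/-- The elements which are `X`-suffixes of letters of `Y^{±1}`, and the identity. -/
def suffixes (X Y : Set F) : Set F := {s | s = 1 ∨ ∃ z ∈ symm Y, nf X s <:+ nf X z}

/-- The `Y`-prefixes of the elements of `suffixes X Y`. -/
def hull (X Y : Set F) : Set F := {v | ∃ s ∈ suffixes X Y, nf Y v <+: nf Y s}

lemma IsBasis.finite_suffixes (hX : IsBasis X) (hY : Y.Finite) : (suffixes X Y).Finite := by
  have h1 : (symm Y).Finite := hY.union hY.inv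
  refine ((Set.finite_singleton (1 : F)).union
    (h1.biUnion fun z _ => ((nf X z).tails.map List.prod).finite_toSet)).subset ?_
  rintro s (rfl | ⟨z, hz, hs⟩)
  · exact Or.inl rfl
  · refine Or.inr (Set.mem_biUnion hz ?_)
    exact List.mem_map.2 ⟨_, (List.mem_tails _ _).2 hs, hX.nf_prod s⟩

lemma IsBasis.finite_hull (hX : IsBasis X) (hY : IsBasis Y) (hfin : Y.Finite) :
    (hull X Y).Finite := by
  refine ((hX.finite_suffixes hfin).biUnion
    fun s _ => ((nf Y s).inits.map List.prod).finite_toSet).subset ?_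
  rintro v ⟨s, hs, hv⟩
  refine Set.mem_biUnion hs ?_
  exact List.mem_map.2 ⟨_, (List.mem_inits _ _).2 hv, hY.nf_prod v⟩

lemma suffixes_of_suffix {s t : F} (hs : s ∈ suffixes X Y) (hX : IsBasis X)
    (h : nf X t <:+ nf X s) : t ∈ suffixes X Y := by
  rcases hs with rfl | ⟨z, hz, hs⟩
  · rw [hX.nf_one, List.suffix_nil] at h
    exact Or.inl (by rw [← hX.nf_prod t, h, List.prod_nil])
  · exact Or.inr ⟨z, hz, h.trans hs⟩

lemma IsBasis.one_mem_hull (hY : IsBasis Y) : (1 : F) ∈ hull X Y :=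
  ⟨1, Or.inl rfl, by rw [hY.nf_one]⟩

/-- The claim is that the hull is closed under `X`-suffixes. If `l.prod⁻¹` were missing, left
translation by `l.prod` would send all of `suffixes X Y` into one `Y`-half-space. A `Y`-path from 1
that avoids this half-space then cannot enter the translate of `side X x` by `l.prod`, although some
point outside the half-space lies in that translate. -/
lemma IsBasis.conv_inv_hull (hX : IsBasis X) (hY : IsBasis Y) : Conv X (hull X Y)⁻¹ := by
  refine hX.conv_of_prefix fun l m hlm h => ?_
  obtain ⟨hl, hm, hj⟩ := isReducedSeq_append.1 hlm
  cases m with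
  | nil => rwa [List.append_nil] at h
  | cons x m =>
  by_cases hl1 : l.prod = 1
  · rw [hl1, Set.mem_inv, inv_one]; exact hY.one_mem_hull
  obtain ⟨y, hy, hly⟩ := hY.exists_mem_side hl1
  by_contra hcon
  -- Otherwise `l.prod⁻¹` would be a `Y`-prefix of `t`, hence in the hull.
  have hB : ∀ t ∈ suffixes X Y, l.prod * t ∈ side Y y := by
    intro t ht
    by_contra h1
    refine hcon ⟨t, ht, ?_⟩
    have h2 := hY.nf_inv_mul (g := l.prod) (k := l.prod * t) fun z hz hz' =>
      h1 (side_disjoint hly hz ▸ hz')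
    rw [inv_mul_cancel_left] at h2
    exact h2 ▸ List.prefix_append _ _
  have hmx := hX.cons_mem_side hm
  obtain ⟨s, hs, r, hr⟩ := h
  -- Here `r` is what follows the prefix `(l ++ x :: m).prod⁻¹` in the normal form of `s`. That
  -- prefix ends in `y⁻¹`, so `r` cannot begin with `y`.
  have hend : (l ++ x :: m).prod ∈ side Y y → (l ++ x :: m).prod * s ∉ side Y y := by
    intro h1 h2
    have h3 : r.prod = (l ++ x :: m).prod * s := by
      have h4 := hY.nf_prod s
      rw [← hr, List.prod_append, hY.nf_prod] at h4
      rw [← h4, mul_inv_cancel_left]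
    have h4 := hY.nf_reduced s
    rw [← hr] at h4
    obtain ⟨-, h5, h6⟩ := isReducedSeq_append.1 h4
    rw [← h3, hY.mem_side_of_reduced h5] at h2
    refine h6 y⁻¹ ?_ y h2 (inv_inv y).symm
    rw [hY.nf_inv, List.getLast?_reverse, List.head?_map, Option.mem_def, h1]
    rfl
  obtain ⟨p, hp1, hp2⟩ : ∃ p, p ∉ side Y y ∧ l.prod⁻¹ * p ∈ side X x := by
    by_cases h1 : (l ++ x :: m).prod ∈ side Y y
    · refine ⟨_, hend h1, ?_⟩
      rw [List.prod_append, mul_assoc, inv_mul_cancel_left]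
      by_contra h2
      have h3 := hX.nf_inv_mul (g := (x :: m).prod) (k := (x :: m).prod * s) fun z hz hz' =>
        h2 (side_disjoint hmx hz ▸ hz')
      rw [inv_mul_cancel_left] at h3
      have h4 := hB _ (suffixes_of_suffix hs hX (t := (x :: m).prod * s)
        (h3 ▸ List.suffix_append _ _))
      rw [← mul_assoc, ← List.prod_append] at h4
      exact hend h1 h4
    · refine ⟨_, h1, ?_⟩
      rwa [List.prod_append, inv_mul_cancel_left]
  -- If the step `t` enters the translated `X`-half-space, its end, translated back, is an
  -- `X`-suffix of `t`; then `hB` puts the end of the path in `side Y y`.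
  have key : ∀ k, IsReducedSeq Y k → k.prod ∉ side Y y → l.prod⁻¹ * k.prod ∉ side X x := by
    intro k
    induction k using List.reverseRecOn with
    | nil =>
      intro _ _ h1
      rw [List.prod_nil, mul_one, ← prod_map_inv_reverse, hX.mem_side_of_reduced hl.inv,
        List.head?_reverse, List.getLast?_map, Option.map_eq_some_iff] at h1
      obtain ⟨a, ha, rfl⟩ := h1
      exact hj a ha _ rfl rfl
    | append_singleton k t ih =>
      intro hk hk1 hk2
      obtain ⟨h1, h2, -⟩ := isReducedSeq_append.1 hk
      have h3 : k.prod ∉ side Y y := by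
        rw [hY.mem_side_of_reduced h1]
        rw [hY.mem_side_of_reduced hk] at hk1
        intro h4
        exact hk1 (by rw [List.head?_append, h4]; rfl)
      have h4 := ih h1 h3
      have h5 := hX.nf_inv_mul (g := l.prod⁻¹ * k.prod) (k := l.prod⁻¹ * (k ++ [t]).prod)
        fun z hz hz' => h4 (side_disjoint hk2 hz' ▸ hz)
      have h6 : (l.prod⁻¹ * k.prod)⁻¹ * (l.prod⁻¹ * (k ++ [t]).prod) = t := by
        rw [List.prod_append, List.prod_singleton]; group
      rw [h6] at h5
      have h7 := hB _ (Or.inr ⟨t, h2.mem_symm, h5 ▸ List.suffix_append _ _⟩)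
      rw [mul_inv_cancel_left] at h7
      exact hk1 h7
  refine key (nf Y p) (hY.nf_reduced p) ?_ ?_ <;> rwa [hY.nf_prod]

lemma exists_finite_translator (hX : IsBasis X) (hY : IsBasis Y) (hfin : Y.Finite) :
    ∃ V, IsTranslator X Y V ∧ V.Finite := by
  refine ⟨hull X Y, (isTranslator_iff hX hY).2 ⟨hY.one_mem_hull, ?_, hX.conv_inv_hull hY, ?_⟩,
    hX.finite_hull hY hfin⟩
  · rw [eq_top_iff, ← hY.closure_eq_top, Subgroup.closure_le]
    exact fun y hy => Subgroup.subset_closure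
      ⟨y, Or.inr ⟨y, Or.inl hy, List.suffix_refl _⟩, List.prefix_refl _⟩
  · refine hY.conv_of_prefix fun l m hlm ⟨s, hs, h⟩ => ⟨s, hs, ?_⟩
    rw [hY.nf_eq hlm] at h
    rw [hY.nf_eq (isReducedSeq_append.1 hlm).1]
    exact (List.prefix_append l m).trans h

/-! ### Lengths of words -/

lemma IsBasis.length_nf_le (hY : IsBasis Y) {l : List F} (hl : ∀ a ∈ l, a ∈ symm Y) :
    (nf Y l.prod).length ≤ l.length := by
  obtain ⟨m, hm, h1, h2⟩ := exists_reduced_of_list hl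
  rwa [← h1, hY.nf_eq hm]

lemma IsBasis.length_straight (hY : IsBasis Y) (g : F) :
    (Word.straight g).length Y = (nf Y g).length := by
  have : {n | ∃ σ : List F, IsReducedSeq Y σ ∧ σ.prod = g ∧ σ.length = n} = {(nf Y g).length} := by
    ext n
    constructor
    · rintro ⟨σ, h1, rfl, rfl⟩
      rw [hY.nf_eq h1]; rfl
    · rintro rfl
      exact ⟨_, hY.nf_reduced g, hY.nf_prod g, rfl⟩
  rw [Word.length, this, csInf_singleton]

lemma isCyclicallyReducedSeq_iff {l : List F} : IsCyclicallyReducedSeq Y l ↔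
    IsReducedSeq Y l ∧ ∀ a ∈ l.getLast?, ∀ b ∈ l.head?, b ≠ a⁻¹ := by
  rw [IsCyclicallyReducedSeq, isReducedSeq_append]; tauto

/-- A reduced sequence that is not cyclically reduced begins and ends with inverse letters. -/
lemma IsBasis.exists_eq_of_not_cyclicallyReduced (hY : IsBasis Y) {l : List F}
    (hl : IsReducedSeq Y l) (h : ¬ IsCyclicallyReducedSeq Y l) :
    ∃ a m, l = a :: (m ++ [a⁻¹]) := by
  rw [isCyclicallyReducedSeq_iff] at h
  push Not at h
  obtain ⟨a, ha, b, hb, rfl⟩ := h hl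
  cases l with
  | nil => simp at hb
  | cons c l =>
    obtain rfl : c = a⁻¹ := by simpa using hb
    rcases List.eq_nil_or_concat l with rfl | ⟨m, d, rfl⟩
    · have : a⁻¹ = a := by simpa using ha
      exact absurd (by rw [inv_inv, this]) (hY.inv_ne hl.mem_symm)
    · refine ⟨a⁻¹, m, ?_⟩
      have : d = a := by simpa [List.getLast?_cons] using ha
      simp [this]

lemma IsBasis.exists_cyclicallyReduced (hY : IsBasis Y) {l : List F} (hl : ∀ a ∈ l, a ∈ symm Y) :
    ∃ σ, IsCyclicallyReducedSeq Y σ ∧ ConjClasses.mk σ.prod = ConjClasses.mk l.prod ∧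
      σ.length ≤ l.length := by
  induction hn : l.length using Nat.strong_induction_on generalizing l with
  | _ n ih =>
    subst hn
    obtain ⟨m, hm, hp, hlen⟩ := exists_reduced_of_list hl
    by_cases hc : IsCyclicallyReducedSeq Y m
    · exact ⟨m, hc, by rw [hp], hlen⟩
    · obtain ⟨a, k, rfl⟩ := hY.exists_eq_of_not_cyclicallyReduced hm hc
      simp only [List.length_cons, List.length_append, List.length_nil] at hlen
      obtain ⟨σ, h1, h2, h3⟩ := ih k.length (by omega)
        (fun b hb => hm.1 b (by simp [hb])) rfl
      refine ⟨σ, h1, ?_, by omega⟩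
      rw [h2, ← hp, ConjClasses.mk_eq_mk_iff_isConj, isConj_iff]
      exact ⟨a, by simp [mul_assoc]⟩

lemma IsBasis.exists_list_conj (hY : IsBasis Y) (c : ConjClasses F) :
    ∃ l : List F, (∀ a ∈ l, a ∈ symm Y) ∧ ConjClasses.mk l.prod = c := by
  obtain ⟨g, rfl⟩ := ConjClasses.exists_rep c
  obtain ⟨l, hl, rfl⟩ := hY.exists_list g
  exact ⟨l, hl, rfl⟩

lemma IsCyclicallyReducedSeq.pow {σ : List F} (h : IsCyclicallyReducedSeq Y σ) (k : ℕ) :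
    IsReducedSeq Y (List.replicate k σ).flatten ∧
      (∀ b ∈ (List.replicate k σ).flatten.head?, b ∈ σ.head?) := by
  rw [isCyclicallyReducedSeq_iff] at h
  induction k with
  | zero => exact ⟨.nil, by simp⟩
  | succ k ih =>
    rw [List.replicate_succ, List.flatten_cons, isReducedSeq_append]
    refine ⟨⟨h.1, ih.1, fun a ha b hb => h.2 a ha b (ih.2 b hb)⟩, fun b hb => ?_⟩
    rw [List.head?_append] at hb
    cases hσ : σ.head? with
    | none => rw [hσ] at hb; rw [← hσ]; exact ih.2 b hb
    | some c => rwa [hσ] at hb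

lemma prod_flatten_replicate (σ : List F) (k : ℕ) :
    (List.replicate k σ).flatten.prod = σ.prod ^ k := by
  rw [List.prod_flatten, List.map_replicate, List.prod_replicate]

lemma IsBasis.length_nf_pow (hY : IsBasis Y) {σ : List F} (h : IsCyclicallyReducedSeq Y σ)
    (k : ℕ) : (nf Y (σ.prod ^ k)).length = k * σ.length := by
  rw [← prod_flatten_replicate, hY.nf_eq (h.pow k).1]
  simp

/-- Lengths of powers of cyclically reduced sequences grow linearly, while conjugation by `g`
changes length by at most twice the length of `g`. -/
lemma IsBasis.length_le_of_conj (hY : IsBasis Y) {σ τ : List F} (hσ : IsCyclicallyReducedSeq Y σ)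
    (hτ : IsCyclicallyReducedSeq Y τ) (h : IsConj σ.prod τ.prod) : τ.length ≤ σ.length := by
  obtain ⟨g, hg⟩ := isConj_iff.1 h
  by_contra! hlt
  -- The exponent exceeds the conjugation error, so a gain of one letter per period is already
  -- contradictory.
  set k := 2 * (nf Y g).length + 1 with hk
  have h1 : τ.prod ^ k = (nf Y g ++ (nf Y (σ.prod ^ k) ++ nf Y g⁻¹)).prod := by
    simp only [List.prod_append, hY.nf_prod]
    rw [← hg, conj_pow, mul_assoc]
  have h2 := hY.length_nf_pow hτ k
  have h3 := hY.length_nf_le (l := nf Y g ++ (nf Y (σ.prod ^ k) ++ nf Y g⁻¹)) (by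
    intro a ha
    simp only [List.mem_append] at ha
    rcases ha with ha | ha | ha
    exacts [(hY.nf_reduced _).1 a ha, (hY.nf_reduced _).1 a ha, (hY.nf_reduced _).1 a ha])
  rw [← h1, h2] at h3
  have h4 : (nf Y g⁻¹).length = (nf Y g).length := by rw [hY.nf_inv]; simp
  simp only [List.length_append, hY.length_nf_pow hσ, h4] at h3
  have h5 : k * σ.length + k ≤ k * τ.length := by
    rw [← Nat.mul_succ]; exact Nat.mul_le_mul_left _ hlt
  omega

lemma IsBasis.length_cyclic (hY : IsBasis Y) {σ : List F} (hσ : IsCyclicallyReducedSeq Y σ) :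
    (Word.cyclic (ConjClasses.mk σ.prod)).length Y = σ.length := by
  have : {n | ∃ τ : List F, IsCyclicallyReducedSeq Y τ ∧
      ConjClasses.mk τ.prod = ConjClasses.mk σ.prod ∧ τ.length = n} = {σ.length} := by
    ext n
    constructor
    · rintro ⟨τ, h1, h2, rfl⟩
      rw [ConjClasses.mk_eq_mk_iff_isConj] at h2
      exact le_antisymm (hY.length_le_of_conj hσ h1 h2.symm) (hY.length_le_of_conj h1 hσ h2)
    · rintro rfl
      exact ⟨σ, hσ, rfl, rfl⟩
  rw [Word.length, this, csInf_singleton]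

lemma IsBasis.length_cyclic_le (hY : IsBasis Y) {l : List F} (hl : ∀ a ∈ l, a ∈ symm Y) :
    (Word.cyclic (ConjClasses.mk l.prod)).length Y ≤ l.length := by
  obtain ⟨σ, h1, h2, h3⟩ := hY.exists_cyclicallyReduced hl
  rw [← h2, hY.length_cyclic h1]
  exact h3

/-! ### Walks -/

/-- The end of a step that begins at `v`: along an `X`-edge from `v` to `x⁻¹ * v`, or along a
`Y`-edge from `v` to `v * y`. -/
def move (v : F) : F ⊕ F → F
  | .inl x => x⁻¹ * v
  | .inr y => v * y

/-- All the vertices of the walk from `v` with the given steps lie in `V`. -/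
def Stays (V : Set F) : F → List (F ⊕ F) → Prop
  | v, [] => v ∈ V
  | v, s :: l => v ∈ V ∧ Stays V (move v s) l

/-- The `X`-steps of a walk. -/
def lefts (l : List (F ⊕ F)) : List F := l.filterMap Sum.getLeft?

/-- The `Y`-steps of a walk. -/
def rights (l : List (F ⊕ F)) : List F := l.filterMap Sum.getRight?

section
omit [Group F]
@[simp] lemma lefts_nil : lefts ([] : List (F ⊕ F)) = [] := rfl
@[simp] lemma rights_nil : rights ([] : List (F ⊕ F)) = [] := rfl
@[simp] lemma lefts_inl (x : F) (l) : lefts (.inl x :: l) = x :: lefts l := rfl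
@[simp] lemma lefts_inr (x : F) (l) : lefts (.inr x :: l) = lefts l := rfl
@[simp] lemma rights_inl (x : F) (l) : rights (.inl x :: l) = rights l := rfl
@[simp] lemma rights_inr (x : F) (l) : rights (.inr x :: l) = x :: rights l := rfl
end

lemma Stays.mem {V : Set F} {v : F} {l : List (F ⊕ F)} (h : Stays V v l) : v ∈ V := by
  cases l with
  | nil => exact h
  | cons => exact h.1

/-- This is where generation is used: if no edge in `V` had label `y`, the paths in `V` from 1 would
place all of `V` in the subgroup generated by `Y \ {y}`. -/
lemma IsTranslator.exists_right (hX : IsBasis X) (hY : IsBasis Y) {V : Set F}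
    (hV : IsTranslator X Y V) {y : F} (hy : y ∈ symm Y) : ∃ v ∈ V, v * y ∈ V := by
  have key : ∀ y ∈ Y, ∃ v ∈ V, v * y ∈ V := by
    intro y hy
    by_contra! hcon
    rw [isTranslator_iff hX hY] at hV
    refine hY.notMem_closure hy ?_
    suffices h : Subgroup.closure V ≤ Subgroup.closure (Y \ {y}) from h (by rw [hV.2.1]; trivial)
    rw [Subgroup.closure_le]
    intro v hv
    have h1 := hY.isConn hV.2.2.2 1 hV.1 v hv
    induction h1 with
    | refl => exact Subgroup.one_mem _
    | @tail p q _ hpq ih =>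
      rw [← mul_inv_cancel_left p q]
      refine mul_mem (ih hpq.1) ?_
      rcases hpq.2.2 with h | h
      · refine Subgroup.subset_closure ⟨h, ?_⟩
        rintro rfl
        exact hcon p hpq.1 (by simpa using hpq.2.1)
      · rw [← inv_inv (p⁻¹ * q)]
        refine inv_mem (Subgroup.subset_closure ⟨h, ?_⟩)
        rintro rfl
        exact hcon q hpq.2.1 (by simpa using hpq.1)
  rcases hy with hy | hy
  · exact key y hy
  · obtain ⟨v, hv, hvy⟩ := key _ hy
    exact ⟨_, hvy, by simpa⟩

lemma IsTranslator.exists_left (hX : IsBasis X) (hY : IsBasis Y) {V : Set F}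
    (hV : IsTranslator X Y V) {x : F} (hx : x ∈ symm X) : ∃ v ∈ V, x⁻¹ * v ∈ V := by
  obtain ⟨v, hv, h⟩ := (hV.inv hX hY).exists_right hY hX hx
  exact ⟨v⁻¹, hv, by simpa using h⟩

lemma Conv.append_mem {C : Set F} (hC : Conv Y C) {v : F} (hv : v ∈ C) {l m : List F}
    (h : IsReducedSeq Y (l ++ m)) (h' : v * (l ++ m).prod ∈ C) : v * l.prod ∈ C := by
  induction l generalizing v with
  | nil => simpa
  | cons z l ih =>
    have := ih (hC v hv z _ h h') h.tail (by simpa [mul_assoc] using h')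
    simpa [mul_assoc] using this

/-- Suppose that neither step is possible. Consecutive translates of `V` by the prefixes of `x ::
xs` overlap, because each `X`-label occurs in `V`. The first translate to reach beyond the edge from
`v` to `v * y` would contain `v`, and `X`-convexity would then permit the step along `x`. So none
reaches it, although the endpoint of the required walk lies beyond it. -/
lemma step_mem (hY : IsBasis Y) {V : Set F} (hYV : Conv Y V) (hXV : Conv X V⁻¹)
    (hov : ∀ x ∈ symm X, ∃ v ∈ V, x⁻¹ * v ∈ V) {v x y : F} {xs ys : List F} (hv : v ∈ V)
    (hxs : IsReducedSeq X (x :: xs)) (hys : IsReducedSeq Y (y :: ys))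
    (h : (x :: xs).prod⁻¹ * v * (y :: ys).prod ∈ V) : x⁻¹ * v ∈ V ∨ v * y ∈ V := by
  by_contra! hcon
  have h0 : v⁻¹ * v ∉ side Y y := by rw [inv_mul_cancel]; exact hY.one_notMem_side
  have key : ∀ p q, p ++ q = x :: xs → ∀ w, p.prod⁻¹ * w ∈ V → v⁻¹ * w ∉ side Y y := by
    intro p
    induction p using List.reverseRecOn with
    | nil =>
      intro q _ w hw hws
      exact hcon.2 (hY.edge_mem hYV hv (by simpa using hw) h0 hws).2
    | append_singleton p t ih =>
      intro q hq w hw hws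
      have hq' : p ++ (t :: q) = x :: xs := by simpa using hq
      -- The point `p.prod * u` lies in both the old and the new translate.
      obtain ⟨u, hu, htu⟩ := hov t (hxs.1 t (by rw [← hq']; simp))
      have h1 := ih _ hq' (p.prod * u) (by simpa)
      have h2 := (hY.edge_mem (hYV.preimage_mul (p ++ [t]).prod⁻¹) (p := p.prod * u)
        (by simpa [mul_assoc] using htu) hw h1 hws).1
      obtain ⟨r, hr⟩ : ∃ r, p ++ [t] = x :: r := by
        cases p with
        | nil => exact ⟨[], by simpa using (List.cons.inj hq').1⟩
        | cons a p => exact ⟨p ++ [t], by simpa using (List.cons.inj hq').1⟩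
      have h3 : v⁻¹ * x ∈ V⁻¹ := by
        refine hXV v⁻¹ (by simpa) x r ?_ ?_
        · rw [← hr]; rw [← hq] at hxs; exact (isReducedSeq_append.1 hxs).1
        · rw [← hr, Set.mem_inv, mul_inv_rev, inv_inv]; exact h2
      exact hcon.1 (by simpa using h3)
  refine key (x :: xs) [] (by simp) (v * (y :: ys).prod) (by rwa [← mul_assoc]) ?_
  rw [inv_mul_cancel_left]
  exact hY.cons_mem_side hys

/-- Two vertices of `V` are joined, in `V`, by a walk that is geodesic for both bases. -/
lemma exists_walk (hY : IsBasis Y) {V : Set F} (hYV : Conv Y V) (hXV : Conv X V⁻¹)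
    (hov : ∀ x ∈ symm X, ∃ v ∈ V, x⁻¹ * v ∈ V) (xs ys : List F) {v : F} (hv : v ∈ V)
    (hxs : IsReducedSeq X xs) (hys : IsReducedSeq Y ys) (h : xs.prod⁻¹ * v * ys.prod ∈ V) :
    ∃ l, Stays V v l ∧ lefts l = xs ∧ rights l = ys := by
  induction xs generalizing v ys with
  | nil =>
    induction ys generalizing v with
    | nil => exact ⟨[], hv, rfl, rfl⟩
    | cons y ys ih =>
      have h1 : v * y ∈ V := hYV v hv y ys hys (by simpa using h)
      obtain ⟨l, h2, h3, h4⟩ := ih h1 hys.tail (by simpa [mul_assoc] using h)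
      exact ⟨.inr y :: l, ⟨hv, h2⟩, by simpa, by simpa⟩
  | cons x xs ihx =>
    have left : ∀ {ys v}, v ∈ V → IsReducedSeq Y ys → (x :: xs).prod⁻¹ * v * ys.prod ∈ V →
        x⁻¹ * v ∈ V → ∃ l, Stays V v l ∧ lefts l = x :: xs ∧ rights l = ys := by
      intro ys v hv hys h h1
      obtain ⟨l, h2, h3, h4⟩ := ihx ys h1 hxs.tail hys (by simpa [mul_assoc] using h)
      exact ⟨.inl x :: l, ⟨hv, h2⟩, by simpa, by simpa⟩
    induction ys generalizing v with
    | nil =>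
      have h1 : v⁻¹ * x ∈ V⁻¹ := hXV v⁻¹ (by simpa) x xs hxs (by simpa [mul_assoc] using h)
      exact left hv hys h (by simpa using h1)
    | cons y ys ih =>
      rcases step_mem hY hYV hXV hov hv hxs hys h with h1 | h1
      · exact left hv hys h h1
      · obtain ⟨l, h2, h3, h4⟩ := ih h1 hys.tail (by simpa [mul_assoc] using h)
        exact ⟨.inr y :: l, ⟨hv, h2⟩, by simpa, by simpa⟩

/-- Used with `Stays.last_left` to show that minimality of the base point makes the `X`-steps
cyclically reduced: both locate ends of `X`-edges of the walk relative to its base point and its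
end. -/
lemma Stays.first_left {V : Set F} {v x : F} {l : List (F ⊕ F)} {xs : List F}
    (h : Stays V v l) (hl : lefts l = x :: xs) :
    ∃ p q, p ++ q = rights l ∧ x⁻¹ * v * p.prod ∈ V := by
  induction l generalizing v with
  | nil => simp at hl
  | cons s l ih =>
    rcases s with a | a
    · obtain rfl : a = x := (List.cons.inj (by simpa using hl)).1
      exact ⟨[], rights l, rfl, by simpa [move] using h.2.mem⟩
    · obtain ⟨p, q, h1, h2⟩ := ih h.2 (by simpa using hl)
      exact ⟨a :: p, q, by simpa using h1, by simpa [move, mul_assoc] using h2⟩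

lemma Stays.last_left {V : Set F} {v w x : F} {l : List (F ⊕ F)} {xs : List F}
    (h : Stays V v l) (hw : (lefts l).prod⁻¹ * v * (rights l).prod = w) (hl : lefts l = xs ++ [x]) :
    ∃ p q, p ++ q = rights l ∧ x * w * q.prod⁻¹ ∈ V := by
  induction l generalizing v xs with
  | nil => simp at hl
  | cons s l ih =>
    rcases s with a | a
    · cases xs with
      | nil =>
        obtain ⟨rfl, h1⟩ : a = x ∧ lefts l = [] := by simpa using hl
        refine ⟨[], rights l, rfl, ?_⟩
        rw [← hw]
        simpa [h1, mul_assoc] using h.1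
      | cons b xs =>
        obtain ⟨rfl, h1⟩ : a = b ∧ lefts l = xs ++ [x] := by simpa using hl
        exact ih h.2 (by simpa [move, mul_assoc] using hw) h1
    · obtain ⟨p, q, h1, h2⟩ := ih h.2 (by simpa [move, mul_assoc] using hw) (by simpa using hl)
      exact ⟨a :: p, q, by simpa using h1, h2⟩

/-- A closed walk in `V`, based at `v`, that represents the word `r` and is not longer than
necessary with respect to both bases. -/
structure Realizes (X Y V : Set F) (r : Word F) (v : F) (l : List (F ⊕ F)) : Prop where
  stays : Stays V v l
  closed : (lefts l).prod⁻¹ * v * (rights l).prod = v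
  lefts_mem : ∀ a ∈ lefts l, a ∈ symm X
  rights_mem : ∀ a ∈ rights l, a ∈ symm Y
  lefts_length : (lefts l).length ≤ r.length X
  rights_length : (rights l).length ≤ r.length Y
  spells : (∃ g, r = .straight g ∧ v = 1 ∧ (rights l).prod = g) ∨
    r = .cyclic (ConjClasses.mk (rights l).prod)

/-- A straight word is a closed walk based at 1 that is geodesic for both bases. For a cyclic word,
the `Y`-steps are chosen cyclically reduced, and the base point is chosen to make the `X`-steps
cyclically reduced too. -/
lemma IsTranslator.exists_realizes (hX : IsBasis X) (hY : IsBasis Y) {V : Set F}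
    (hV : IsTranslator X Y V) (r : Word F) : ∃ v l, Realizes X Y V r v l := by
  have hov := fun x (hx : x ∈ symm X) => hV.exists_left hX hY hx
  obtain ⟨h1, -, hXV, hYV⟩ := (isTranslator_iff hX hY).1 hV
  rcases r with g | c
  · obtain ⟨l, h2, h3, h4⟩ := exists_walk hY hYV hXV hov (nf X g) (nf Y g) h1 (hX.nf_reduced g)
      (hY.nf_reduced g) (by simpa [hX.nf_prod, hY.nf_prod] using h1)
    refine ⟨1, l, h2, by simp [h3, h4, hX.nf_prod, hY.nf_prod], ?_, ?_, ?_, ?_,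
      Or.inl ⟨g, rfl, rfl, by rw [h4, hY.nf_prod]⟩⟩
    · rw [h3]; exact (hX.nf_reduced g).1
    · rw [h4]; exact (hY.nf_reduced g).1
    · rw [h3, hX.length_straight]
    · rw [h4, hY.length_straight]
  · obtain ⟨l, hl, rfl⟩ := hY.exists_list_conj c
    obtain ⟨ys, hys, hc, -⟩ := hY.exists_cyclicallyReduced hl
    rw [← hc]
    set g := ys.prod with hg
    obtain ⟨v, hv, hmin⟩ := exists_minimalFor_of_wellFoundedLT (· ∈ V)
      (fun v => (nf X (v * g * v⁻¹)).length) ⟨1, h1⟩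
    have hysr := (isCyclicallyReducedSeq_iff.1 hys).1
    obtain ⟨l, h2, h3, h4⟩ := exists_walk hY hYV hXV hov (nf X (v * g * v⁻¹)) ys hv
      (hX.nf_reduced _) hysr (by rw [hX.nf_prod, ← hg]; simpa [mul_assoc] using hv)
    have hcl : (lefts l).prod⁻¹ * v * (rights l).prod = v := by
      rw [h3, h4, hX.nf_prod, ← hg]; group
    have hcyc : IsCyclicallyReducedSeq X (nf X (v * g * v⁻¹)) := by
      by_contra hcon
      obtain ⟨x, m, hm⟩ := hX.exists_eq_of_not_cyclicallyReduced (hX.nf_reduced _) hcon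
      rw [hm] at h3
      obtain ⟨p, q, hpq, hp⟩ := h2.first_left h3
      obtain ⟨p', q', hpq', hq'⟩ := h2.last_left hcl (xs := x :: m) (by rw [h3]; rfl)
      -- The first and last `X`-steps have inverse labels, so there are vertices of `V` on both
      -- sides of `x⁻¹ * v` along one `Y`-line. The sequence `q' ++ p` is reduced because `ys` is
      -- cyclically reduced, and convexity yields `x⁻¹ * v`, a base point with a shorter conjugate.
      have h5 : x⁻¹ * v ∈ V := by
        have h6 : IsReducedSeq Y (q' ++ p) := by
          have h7 : IsReducedSeq Y (ys ++ ys) := hys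
          rw [← h4] at h7
          nth_rw 1 [← hpq'] at h7
          rw [← hpq, List.append_assoc, ← List.append_assoc q'] at h7
          exact (isReducedSeq_append.1 (isReducedSeq_append.1 h7).2.1).1
        have := hYV.append_mem hq' h6 (by simpa [mul_assoc] using hp)
        simpa [mul_assoc] using this
      have h8 : x⁻¹ * v * g * (x⁻¹ * v)⁻¹ = m.prod := by
        have : x⁻¹ * v * g * (x⁻¹ * v)⁻¹ = x⁻¹ * (v * g * v⁻¹) * x := by group
        rw [this, ← hX.nf_prod (v * g * v⁻¹), hm]
        simp [mul_assoc]
      have h9 : (nf X (x⁻¹ * v * g * (x⁻¹ * v)⁻¹)).length ≤ m.length := by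
        rw [h8]
        refine hX.length_nf_le fun a ha => (hX.nf_reduced (v * g * v⁻¹)).1 a ?_
        rw [hm]; simp [ha]
      have h10 := hmin h5 (by
        change (nf X (x⁻¹ * v * g * (x⁻¹ * v)⁻¹)).length ≤ (nf X (v * g * v⁻¹)).length
        refine h9.trans ?_
        rw [hm]
        simp only [List.length_cons, List.length_append]
        omega)
      change (nf X (v * g * v⁻¹)).length ≤ (nf X (x⁻¹ * v * g * (x⁻¹ * v)⁻¹)).length at h10
      rw [hm] at h10
      simp only [List.length_cons, List.length_append] at h10
      omega
    refine ⟨v, l, h2, hcl, ?_, ?_, ?_, ?_, Or.inr (by rw [h4])⟩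
    · rw [h3]; exact (hX.nf_reduced _).1
    · rw [h4]; exact hysr.1
    · have h5 := hX.length_cyclic hcyc
      rw [hX.nf_prod] at h5
      rw [h3, ← h5]
      refine le_of_eq (congrArg (fun c => (Word.cyclic c).length X) ?_)
      rw [ConjClasses.mk_eq_mk_iff_isConj, isConj_comm, isConj_iff]
      exact ⟨v, rfl⟩
    · rw [h4, hY.length_cyclic hys]

/-! ### Whitehead transforms of bases -/

lemma IsBasis.exists_hom (hY : IsBasis Y) (φ : F → F) : ∃ f : F →* F, ∀ y ∈ Y, f y = φ y := by
  let e : FreeGroup Y ≃* F := MulEquiv.ofBijective _ hY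
  let f : FreeGroup Y →* F := FreeGroup.lift fun y : Y => φ (y : F)
  refine ⟨f.comp e.symm.toMonoidHom, fun y hy => ?_⟩
  have : e.symm y = FreeGroup.of (⟨y, hy⟩ : Y) := by
    rw [MulEquiv.symm_apply_eq]; exact (FreeGroup.lift_apply_of (f := fun x : Y => (x : F)) (x := ⟨y, hy⟩)).symm
  rw [MonoidHom.comp_apply, MulEquiv.coe_toMonoidHom, this, FreeGroup.lift_apply_of]

lemma IsBasis.hom_ext (hY : IsBasis Y) {f g : F →* F} (h : ∀ y ∈ Y, f y = g y) : f = g :=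
  MonoidHom.eq_of_eqOn_top fun x hx => by
    rw [← hY.closure_eq_top] at hx
    exact MonoidHom.eqOn_closure h hx

lemma IsBasis.image (hY : IsBasis Y) {f : F → F} (φ : F ≃* F) (h : ∀ y ∈ Y, φ y = f y) :
    IsBasis (f '' Y) := by
  have h1 : f '' Y = φ '' Y := Set.image_congr fun y hy => (h y hy).symm
  rw [h1]
  let c : FreeGroup Y ≃* FreeGroup (φ '' Y) := FreeGroup.freeGroupCongr (φ.toEquiv.image Y)
  have h2 : (FreeGroup.lift (fun x : φ '' Y => (x : F))).comp c.toMonoidHom =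
      φ.toMonoidHom.comp (FreeGroup.lift fun x : Y => (x : F)) := by
    refine FreeGroup.ext_hom _ _ fun y => ?_
    have h3 : c (FreeGroup.of y) = FreeGroup.of (φ.toEquiv.image Y y) := by
      rw [FreeGroup.freeGroupCongr_apply, FreeGroup.map.of]
    simp only [MonoidHom.comp_apply, MulEquiv.coe_toMonoidHom, h3, FreeGroup.lift_apply_of]
    rfl
  have h3 : FreeGroup.lift (fun x : φ '' Y => (x : F)) ∘ c =
      φ ∘ FreeGroup.lift fun x : Y => (x : F) := funext (DFunLike.congr_fun h2)
  refine (Function.Bijective.of_comp_iff _ c.bijective).1 ?_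
  rw [h3]
  exact φ.bijective.comp hY

open Classical in
/-- The transformation that fixes `b` and maps `y` to `(e y)⁻¹ * y * e y⁻¹`. -/
def twist (e : F → F) (b y : F) : F := if y = b ∨ y = b⁻¹ then y else (e y)⁻¹ * y * e y⁻¹

lemma twist_inv (e : F → F) (b y : F) : twist e b y⁻¹ = (twist e b y)⁻¹ := by
  have : (y⁻¹ = b ∨ y⁻¹ = b⁻¹) ↔ (y = b ∨ y = b⁻¹) := by
    rw [inv_eq_iff_eq_inv, inv_inj, or_comm]
  by_cases h : y = b ∨ y = b⁻¹
  · rw [twist, twist, if_pos h, if_pos (this.2 h)]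
  · rw [twist, twist, if_neg h, if_neg (mt this.1 h), inv_inv]; group

lemma twist_mem {e : F → F} {b y : F} (hy : y ∈ symm Y) : twist e b y ∈ symm (twist e b '' Y) := by
  rcases hy with hy | hy
  · exact Or.inl ⟨y, hy, rfl⟩
  · exact Or.inr ⟨y⁻¹, hy, twist_inv e b y⟩

lemma twist_self (e : F → F) (b : F) : twist e b b = b := if_pos (Or.inl rfl)

/-- Both transformations fix `b`, hence all correcting factors, so the factors of one cancel those
of the other. With the roles exchanged as well, this shows that a twist is an automorphism. -/
lemma IsBasis.twist_comp (hY : IsBasis Y) {e e' : F → F} {b : F} (hb : b ∈ symm Y)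
    (he : ∀ y, e' y = 1 ∨ e' y = b ∨ e' y = b⁻¹) (hee : ∀ y, e' y * e y = 1) {f g : F →* F}
    (hf : ∀ y ∈ Y, f y = twist e b y) (hg : ∀ y ∈ Y, g y = twist e' b y) :
    f.comp g = MonoidHom.id F := by
  have hf' : ∀ y ∈ symm Y, f y = twist e b y := by
    rintro y (hy | hy)
    · exact hf y hy
    · rw [← inv_inv y, map_inv, hf _ hy, ← twist_inv]
  have hfb : f b = b := by rw [hf' b hb, twist_self]
  have hfe : ∀ y, f (e' y) = e' y := fun y => by
    rcases he y with h | h | h <;> simp [h, hfb]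
  refine hY.hom_ext fun y hy => ?_
  rw [MonoidHom.comp_apply, hg y hy, MonoidHom.id_apply]
  by_cases hyb : y = b ∨ y = b⁻¹
  · rw [twist, if_pos hyb, hf y hy, twist, if_pos hyb]
  · rw [twist, if_neg hyb, map_mul, map_mul, map_inv, hf y hy, twist, if_neg hyb, hfe, hfe]
    have h1 := eq_inv_of_mul_eq_one_right (hee y)
    have h2 := eq_inv_of_mul_eq_one_right (hee y⁻¹)
    rw [h1, h2]; group

lemma IsBasis.twist (hY : IsBasis Y) {e : F → F} {b : F} (hb : b ∈ symm Y)
    (he : ∀ y, e y = 1 ∨ e y = b) : IsBasis (twist e b '' Y) := by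
  obtain ⟨f, hf⟩ := hY.exists_hom (WhiteheadGraph.twist e b)
  obtain ⟨g, hg⟩ := hY.exists_hom (WhiteheadGraph.twist (fun y => (e y)⁻¹) b)
  have h1 := hY.twist_comp hb (fun y => by rcases he y with h | h <;> simp [h])
    (fun y => by simp) hf hg
  have h2 := hY.twist_comp hb (fun y => by rcases he y with h | h <;> simp [h])
    (fun y => by simp) hg hf
  exact hY.image (MonoidHom.toMulEquiv f g h2 h1) hf

lemma isWhiteheadTransform_twist {e : F → F} {b : F} (hb : b ∈ symm Y)
    (he : ∀ y, e y = 1 ∨ e y = b) : IsWhiteheadTransform Y (twist e b '' Y) := by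
  refine ⟨b⁻¹, inv_mem_symm hb, ?_⟩
  rintro _ ⟨y, hy, rfl⟩
  rw [inv_inv, twist]
  split_ifs with h
  · refine Set.mem_mul.2 ⟨y, Set.mem_mul.2 ⟨1, by simp, y, hy, by simp⟩, 1, by simp, by simp⟩
  · refine Set.mul_mem_mul (Set.mul_mem_mul ?_ hy) ?_
    · rcases he y with h | h <;> simp [h]
    · rcases he y⁻¹ with h | h <;> simp [h]

/-! ### Surgery along an `X`-edge of a translator -/

/-- The elements on the side of `x⁻¹ * v` of the `X`-edge from `v` to `x⁻¹ * v`. -/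
def cut (X : Set F) (v x : F) : Set F := {s | v * s⁻¹ ∈ side X x}

/-- The two excluded cases are the traversals of the cut edge itself; no other `X`-step changes
sides. -/
lemma IsBasis.cut_iff (hX : IsBasis X) {v x u z : F} (hz : z ∈ symm X)
    (h : ¬ (u = v ∧ z = x)) (h' : ¬ (u = x⁻¹ * v ∧ z = x⁻¹)) :
    u ∈ cut X v x ↔ z⁻¹ * u ∈ cut X v x := by
  have h1 : v * (z⁻¹ * u)⁻¹ = v * u⁻¹ * z := by group
  simp only [cut, Set.mem_ofPred_eq, h1]
  constructor
  · intro h2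
    by_contra h3
    obtain ⟨h4, h5⟩ := hX.side_leave hz h2 h3
    exact h' ⟨by rw [← h4]; group, h5⟩
  · intro h2
    by_contra h3
    obtain ⟨h4, h5⟩ := hX.side_enter hz h3 h2
    exact h ⟨(mul_inv_eq_one.1 h4).symm, h5⟩

lemma IsBasis.left_notMem_cut (hX : IsBasis X) {v x : F} : v ∉ cut X v x := by
  simp only [cut, Set.mem_ofPred_eq, mul_inv_cancel]; exact hX.one_notMem_side

lemma IsBasis.right_mem_cut (hX : IsBasis X) {v x : F} (hx : x ∈ symm X) :
    x⁻¹ * v ∈ cut X v x := by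
  have : v * (x⁻¹ * v)⁻¹ = x := by group
  simp only [cut, Set.mem_ofPred_eq, this]; exact hX.self_mem_side hx

lemma IsBasis.conv_inv_cut (hX : IsBasis X) (v x : F) : Conv X (cut X v x)⁻¹ := by
  have : (cut X v x)⁻¹ = {s | v * s ∈ side X x} := by ext s; simp [cut]
  rw [this]
  exact (hX.conv_side x).preimage_mul v

lemma IsBasis.conv_inv_compl_cut (hX : IsBasis X) (v x : F) : Conv X ((cut X v x)ᶜ)⁻¹ := by
  have : ((cut X v x)ᶜ)⁻¹ = {s | v * s ∈ (side X x)ᶜ} := by ext s; simp [cut]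
  rw [this]
  exact (hX.conv_compl_side x).preimage_mul v

/-- An `X`-edge of the translator `V`, from `v` to `x⁻¹ * v`, and a letter `b` of `Y^{±1}` for which
the vertices of `V` beyond the `X`-edge can be multiplied by `b`: the edges with a label other than
`b` do not cross the cut, and those with label `b` do not cross it away from `1`. -/
structure Surgery (X Y V : Set F) (v x b : F) : Prop where
  translator : IsTranslator X Y V
  left_mem : v ∈ V
  letter_left : x ∈ symm X
  right_mem : x⁻¹ * v ∈ V
  one_notMem : 1 ∉ cut X v x
  letter_right : b ∈ symm Y
  same_side : ∀ y ∈ symm Y, y ≠ b → y ≠ b⁻¹ → ∀ u ∈ V, u * y ∈ V → ∀ w ∈ V, w * y ∈ V →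
    u ∈ cut X v x → w ∈ cut X v x
  inward : ∀ u ∈ V, u * b ∈ V → u * b ∈ cut X v x → u ∈ cut X v x

open Classical in
/-- The correcting factor `b` for the letters whose edges are beyond the cut. -/
def factor (X V : Set F) (v x b y : F) : F :=
  if ∃ u ∈ V, u * y ∈ V ∧ u ∈ cut X v x then b else 1

lemma factor_eq (X V : Set F) (v x b y : F) :
    factor X V v x b y = 1 ∨ factor X V v x b y = b := by
  unfold factor; split_ifs <;> simp

/-- The basis obtained from `Y` by surgery. -/
def surgeryBasis (X Y V : Set F) (v x b : F) : Set F := twist (factor X V v x b) b '' Y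

open Classical in
/-- The factor by which a vertex is moved in a surgery. -/
def shift (X : Set F) (v x b s : F) : F := if s ∈ cut X v x then b else 1

/-- The map on vertices in a surgery. -/
def glue (X : Set F) (v x b s : F) : F := s * shift X v x b s

/-- The step traverses the `X`-edge from `v` to `x⁻¹ * v`, in either direction. -/
def OnLeft (v x : F) : F → F ⊕ F → Prop :=
  fun u s => (u = v ∧ s = .inl x) ∨ (u = x⁻¹ * v ∧ s = .inl x⁻¹)

/-- The step traverses the `Y`-edge from `v` to `v * y`, in either direction. -/
def OnRight (v y : F) : F → F ⊕ F → Prop :=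
  fun u s => (u = v ∧ s = .inr y) ∨ (u = v * y ∧ s = .inr y⁻¹)

/-- The step traverses a `Y`-edge with label `b^{±1}` that crosses the cut. -/
def Crosses (X : Set F) (v x b : F) : F → F ⊕ F → Prop :=
  fun u s => (s = .inr b ∧ u ∈ cut X v x ∧ u * b ∉ cut X v x) ∨
    (s = .inr b⁻¹ ∧ u ∉ cut X v x ∧ u * b⁻¹ ∈ cut X v x)

open Classical in
/-- The number of steps of a walk that have the property `P`. -/
def count (P : F → F ⊕ F → Prop) : F → List (F ⊕ F) → ℕ
  | _, [] => 0
  | u, s :: l => (if P u s then 1 else 0) + count P (move u s) l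

namespace Surgery
variable {V : Set F} {v x b : F}

lemma isBasis (H : Surgery X Y V v x b) (hY : IsBasis Y) : IsBasis (surgeryBasis X Y V v x b) :=
  hY.twist H.letter_right (factor_eq X V v x b)

lemma isWhiteheadTransform (H : Surgery X Y V v x b) :
    IsWhiteheadTransform Y (surgeryBasis X Y V v x b) :=
  isWhiteheadTransform_twist H.letter_right (factor_eq X V v x b)

lemma letter_mem (H : Surgery X Y V v x b) : b ∈ symm (surgeryBasis X Y V v x b) := by
  have := twist_mem (e := factor X V v x b) (b := b) H.letter_right
  rwa [twist_self] at this

lemma factor_eq_shift (H : Surgery X Y V v x b) {u y : F} (hy : y ∈ symm Y) (hyb : y ≠ b)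
    (hyb' : y ≠ b⁻¹) (hu : u ∈ V) (huy : u * y ∈ V) :
    factor X V v x b y = shift X v x b u := by
  unfold factor shift
  congr 1
  rw [eq_iff_iff]
  exact ⟨fun ⟨w, hw, hwy, hwc⟩ => H.same_side y hy hyb hyb' w hw hwy u hu huy hwc,
    fun h => ⟨u, hu, huy, h⟩⟩

/-- A `Y`-edge becomes an edge for the new basis, or is collapsed. -/
lemma right_step (H : Surgery X Y V v x b) {u y : F} (hy : y ∈ symm Y) (hu : u ∈ V)
    (huy : u * y ∈ V) :
    ((shift X v x b u)⁻¹ * y * shift X v x b (u * y) ∈ symm (surgeryBasis X Y V v x b) ∧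
      ¬ Crosses X v x b u (.inr y)) ∨
    (shift X v x b u)⁻¹ * y * shift X v x b (u * y) = 1 := by
  by_cases h1 : y = b
  · subst h1
    by_cases h2 : u ∈ cut X v x <;> by_cases h3 : u * y ∈ cut X v x
    · refine Or.inl ⟨?_, ?_⟩
      · simpa [shift, h2, h3] using H.letter_mem
      · rintro (⟨-, -, h⟩ | ⟨-, h, -⟩)
        exacts [h h3, h h2]
    · exact Or.inr (by simp [shift, h2, h3])
    · exact absurd (H.inward u hu huy h3) h2
    · refine Or.inl ⟨?_, ?_⟩
      · simpa [shift, h2, h3] using H.letter_mem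
      · rintro (⟨-, h, -⟩ | ⟨h, -, h'⟩)
        · exact h2 h
        · rw [← Sum.inr_injective h] at h'
          exact h3 h'
  by_cases h1' : y = b⁻¹
  · subst h1'
    have h4 := H.inward (u * b⁻¹) huy (by simpa)
    rw [inv_mul_cancel_right] at h4
    by_cases h2 : u ∈ cut X v x <;> by_cases h3 : u * b⁻¹ ∈ cut X v x
    · refine Or.inl ⟨?_, ?_⟩
      · simpa [shift, h2, h3] using inv_mem_symm H.letter_mem
      · rintro (⟨h, -, h'⟩ | ⟨-, h, -⟩)
        · rw [← Sum.inr_injective h] at h'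
          exact h' h3
        · exact h h2
    · exact absurd (h4 h2) h3
    · exact Or.inr (by simp [shift, h2, h3])
    · refine Or.inl ⟨?_, ?_⟩
      · simpa [shift, h2, h3] using inv_mem_symm H.letter_mem
      · rintro (⟨-, h, -⟩ | ⟨-, -, h⟩)
        exacts [h2 h, h3 h]
  · refine Or.inl ⟨?_, ?_⟩
    · rw [← H.factor_eq_shift hy h1 h1' hu huy,
        ← H.factor_eq_shift (inv_mem_symm hy) (fun h => h1' (by rw [← h, inv_inv]))
          (fun h => h1 (inv_injective h)) huy (by simpa)]
      have := twist_mem (e := factor X V v x b) (b := b) hy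
      rwa [twist, if_neg (by tauto)] at this
    · rintro (⟨h, -⟩ | ⟨h, -⟩)
      exacts [h1 (Sum.inr_injective h), h1' (Sum.inr_injective h)]

/-- The new letters are read off the glued walk. A `Y`-step keeps its cost unless it crosses the cut
with label `b^{±1}`, when it collapses; an `X`-step is free unless it traverses the cut edge, when a
letter `b^{±1}` is inserted if the shift changes. -/
lemma exists_list (H : Surgery X Y V v x b) (hX : IsBasis X) {l : List (F ⊕ F)} {u : F}
    (hs : Stays V u l) (hl : ∀ a ∈ lefts l, a ∈ symm X) (hr : ∀ a ∈ rights l, a ∈ symm Y) :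
    ∃ m : List F, (∀ a ∈ m, a ∈ symm (surgeryBasis X Y V v x b)) ∧
      m.prod = (shift X v x b u)⁻¹ * (rights l).prod *
        shift X v x b ((lefts l).prod⁻¹ * u * (rights l).prod) ∧
      m.length + count (Crosses X v x b) u l ≤ (rights l).length + count (OnLeft v x) u l := by
  induction l generalizing u with
  | nil => exact ⟨[], by simp, by simp, by simp [count]⟩
  | cons s l ih =>
    obtain ⟨hu, hs⟩ := hs
    rcases s with z | y
    · obtain ⟨m, h1, h2, h3⟩ := ih hs (fun a ha => hl a (by simp [ha])) hr
      have hP : ¬ Crosses X v x b u (.inl z) := by simp [Crosses]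
      rw [count, if_neg hP, count]
      by_cases hD : OnLeft v x u (.inl z)
      · rw [if_pos hD]
        have h4 : (shift X v x b u)⁻¹ * shift X v x b (z⁻¹ * u) = 1 ∨
            (shift X v x b u)⁻¹ * shift X v x b (z⁻¹ * u) ∈
              symm (surgeryBasis X Y V v x b) := by
          have := H.letter_mem
          have := inv_mem_symm H.letter_mem
          unfold shift
          split_ifs <;> simp_all
        rcases h4 with h4 | h4
        · refine ⟨m, h1, ?_, ?_⟩
          · rw [h2, move, ← inv_mul_eq_one.1 h4]; simp [mul_assoc]
          · simp only [rights_inl]; omega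
        · refine ⟨_ :: m, List.forall_mem_cons.2 ⟨h4, h1⟩, ?_, ?_⟩
          · rw [List.prod_cons, h2]; simp [move, mul_assoc]
          · simp only [rights_inl, List.length_cons]; omega
      · rw [if_neg hD]
        have h4 : shift X v x b (z⁻¹ * u) = shift X v x b u := by
          unfold shift
          rw [hX.cut_iff (v := v) (x := x) (u := u) (hl z (by simp))
            (fun h => hD (Or.inl ⟨h.1, by rw [h.2]⟩)) (fun h => hD (Or.inr ⟨h.1, by rw [h.2]⟩))]
        refine ⟨m, h1, ?_, ?_⟩
        · rw [h2, move, h4]; simp [mul_assoc]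
        · simp only [rights_inl]; omega
    · obtain ⟨m, h1, h2, h3⟩ := ih hs hl (fun a ha => hr a (by simp [ha]))
      have hD : ¬ OnLeft v x u (.inr y) := by simp [OnLeft]
      rw [count, count, if_neg hD]
      rcases H.right_step (hr y (by simp)) hu hs.mem with ⟨h4, h5⟩ | h4
      · rw [if_neg h5]
        refine ⟨_ :: m, List.forall_mem_cons.2 ⟨h4, h1⟩, ?_, ?_⟩
        · rw [List.prod_cons, h2]; simp [move, mul_assoc]
        · simp only [rights_inr, List.length_cons]; omega
      · refine ⟨m, h1, ?_, ?_⟩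
        · have h5 : (shift X v x b (u * y))⁻¹ = (shift X v x b u)⁻¹ * y :=
            (eq_inv_of_mul_eq_one_left h4).symm
          rw [h2, move, h5]; simp [mul_assoc]
        · simp only [rights_inr, List.length_cons]; split_ifs <;> omega

/-- Straight words keep their product because 1 is not shifted; cyclic words only need it up to
conjugacy by the shift of the base point. -/
lemma length_le (H : Surgery X Y V v x b) (hX : IsBasis X) (hY : IsBasis Y) {r : Word F} {u : F}
    {l : List (F ⊕ F)} (hl : Realizes X Y V r u l) :
    r.length (surgeryBasis X Y V v x b) + count (Crosses X v x b) u l ≤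
      r.length Y + count (OnLeft v x) u l := by
  obtain ⟨m, h1, h2, h3⟩ := H.exists_list hX hl.stays hl.lefts_mem hl.rights_mem
  have h4 := hl.rights_length
  suffices r.length (surgeryBasis X Y V v x b) ≤ m.length by omega
  rw [hl.closed] at h2
  rcases hl.spells with ⟨g, rfl, rfl, rfl⟩ | rfl
  · have h5 : shift X v x b 1 = 1 := if_neg H.one_notMem
    rw [h5, inv_one, one_mul, mul_one] at h2
    rw [(H.isBasis hY).length_straight, ← h2]
    exact (H.isBasis hY).length_nf_le h1
  · have h5 : ConjClasses.mk (rights l).prod = ConjClasses.mk m.prod := by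
      rw [ConjClasses.mk_eq_mk_iff_isConj, isConj_iff]
      exact ⟨(shift X v x b u)⁻¹, by rw [h2, inv_inv]⟩
    rw [h5]
    exact (H.isBasis hY).length_cyclic_le h1

end Surgery

/-! ### The translator obtained by surgery -/

/-- Connected subsets of a Cayley tree are convex, so only connectedness and generation have to be
verified after a surgery. -/
lemma isTranslator_of_isConn (hX : IsBasis X) (hY : IsBasis Y) {V : Set F} (h1 : 1 ∈ V)
    (hgen : ∀ x ∈ symm X, x ∈ Subgroup.closure V) (hXV : IsConn X V⁻¹) (hYV : IsConn Y V) :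
    IsTranslator X Y V := by
  refine (isTranslator_iff hX hY).2 ⟨h1, ?_, hX.conv hXV, hY.conv hYV⟩
  rw [eq_top_iff, ← hX.closure_eq_top, Subgroup.closure_le]
  exact fun x hx => hgen x (Or.inl hx)

lemma glue_of_mem {v x b s : F} (h : s ∈ cut X v x) : glue X v x b s = s * b := by
  rw [glue, shift, if_pos h]

lemma glue_of_notMem {v x b s : F} (h : s ∉ cut X v x) : glue X v x b s = s := by
  rw [glue, shift, if_neg h, mul_one]

/-- An `X`-edge other than the cut edge has both ends on one side, so gluing moves it as a whole and
preserves its label. -/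
lemma IsBasis.mem_closure_glue (hX : IsBasis X) {V : Set F} {v x b z w : F} (hz : z ∈ symm X)
    (hw : w ∈ V) (hzw : z⁻¹ * w ∈ V) (h : ¬ (w = v ∧ z = x)) (h' : z ≠ x⁻¹) :
    z ∈ Subgroup.closure (glue X v x b '' V) := by
  have h1 := hX.cut_iff (v := v) (x := x) hz h (fun h => h' h.2)
  have h2 : glue X v x b (z⁻¹ * w) = z⁻¹ * glue X v x b w := by
    by_cases h3 : w ∈ cut X v x
    · rw [glue_of_mem h3, glue_of_mem (h1.1 h3), mul_assoc]
    · rw [glue_of_notMem h3, glue_of_notMem (mt h1.2 h3)]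
  have h3 : z = glue X v x b w * (glue X v x b (z⁻¹ * w))⁻¹ := by rw [h2]; group
  rw [h3]
  exact mul_mem (Subgroup.subset_closure (Set.mem_image_of_mem _ hw))
    (inv_mem (Subgroup.subset_closure (Set.mem_image_of_mem _ hzw)))

namespace Surgery
variable {V : Set F} {v x b : F}

lemma conv_left (H : Surgery X Y V v x b) (hX : IsBasis X) (hY : IsBasis Y) : Conv X V⁻¹ :=
  ((isTranslator_iff hX hY).1 H.translator).2.2.1

lemma conv_right (H : Surgery X Y V v x b) (hX : IsBasis X) (hY : IsBasis Y) : Conv Y V :=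
  ((isTranslator_iff hX hY).1 H.translator).2.2.2

lemma one_mem_glue (H : Surgery X Y V v x b) : 1 ∈ glue X v x b '' V :=
  ⟨1, H.translator.one_mem, glue_of_notMem H.one_notMem⟩

lemma linked_glue (H : Surgery X Y V v x b) (hX : IsBasis X) (hY : IsBasis Y) :
    IsConn (surgeryBasis X Y V v x b) (glue X v x b '' V) := by
  rintro _ ⟨u, hu, rfl⟩ _ ⟨w, hw, rfl⟩
  have h := hY.isConn (H.conv_right hX hY) u hu w hw
  clear hw
  induction h with
  | refl => exact .refl
  | @tail p q _ hpq ih =>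
    refine ih.trans ?_
    obtain ⟨hp, hq, hy⟩ := hpq
    obtain ⟨y, rfl⟩ : ∃ y, q = p * y := ⟨p⁻¹ * q, by group⟩
    rw [inv_mul_cancel_left] at hy
    have h1 : glue X v x b (p * y) = glue X v x b p *
        ((shift X v x b p)⁻¹ * y * shift X v x b (p * y)) := by unfold glue; group
    have h2 := Set.mem_image_of_mem (glue X v x b) hq
    rw [h1] at h2 ⊢
    rcases H.right_step hy hp hq with ⟨h3, -⟩ | h3
    · exact .single (Set.mem_image_of_mem _ hp) h3 h2
    · rw [h3, mul_one]; exact .refl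

/-- Both pieces of the cut `X`-tree are convex; after the shift they share the image of `u`, which
equals `u * b`. -/
lemma linked_inv_glue (H : Surgery X Y V v x b) (hX : IsBasis X) (hY : IsBasis Y) {u : F}
    (hu : u ∈ V) (hub : u * b ∈ V) (huc : u ∈ cut X v x) (hubc : u * b ∉ cut X v x) :
    IsConn X (glue X v x b '' V)⁻¹ := by
  have h1 : (glue X v x b '' V)⁻¹ =
      V⁻¹ ∩ ((cut X v x)ᶜ)⁻¹ ∪ {s | b * s ∈ V⁻¹ ∩ (cut X v x)⁻¹} := by
    ext s
    simp only [Set.mem_inv, Set.mem_image, Set.mem_union, Set.mem_inter_iff, Set.mem_compl_iff,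
      Set.mem_ofPred_eq, mul_inv_rev]
    constructor
    · rintro ⟨t, ht, hts⟩
      by_cases htc : t ∈ cut X v x
      · rw [glue_of_mem htc] at hts
        rw [← hts, mul_inv_cancel_right]
        exact Or.inr ⟨ht, htc⟩
      · rw [glue_of_notMem htc] at hts
        rw [← hts]
        exact Or.inl ⟨ht, htc⟩
    · rintro (⟨h, h'⟩ | ⟨h, h'⟩)
      · exact ⟨_, h, glue_of_notMem h'⟩
      · exact ⟨_, h, by rw [glue_of_mem h', inv_mul_cancel_right]⟩
  rw [h1]
  refine (hX.isConn ((H.conv_left hX hY).inter (hX.conv_inv_compl_cut v x))).union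
    (hX.isConn (((H.conv_left hX hY).inter (hX.conv_inv_cut v x)).preimage_mul b))
    (c := (u * b)⁻¹) ?_ ?_
  · simpa using ⟨hub, hubc⟩
  · simpa using ⟨hu, huc⟩

/-- If the `X`-edge is not the only edge of its label, then the surgery produces a translator. -/
lemma isTranslator_glue (H : Surgery X Y V v x b) (hX : IsBasis X) (hY : IsBasis Y) {u w : F}
    (hu : u ∈ V) (hub : u * b ∈ V) (huc : u ∈ cut X v x) (hubc : u * b ∉ cut X v x)
    (hw : w ∈ V) (hxw : x⁻¹ * w ∈ V) (hwv : w ≠ v) :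
    IsTranslator X (surgeryBasis X Y V v x b) (glue X v x b '' V) := by
  refine isTranslator_of_isConn hX (H.isBasis hY) H.one_mem_glue ?_
    (H.linked_inv_glue hX hY hu hub huc hubc) (H.linked_glue hX hY)
  -- Deleting the cut edge costs no generator: the parallel edge at `w` survives with the same
  -- label.
  have h1 : x ∈ Subgroup.closure (glue X v x b '' V) :=
    hX.mem_closure_glue H.letter_left hw hxw (fun h => hwv h.1)
      (hX.inv_ne H.letter_left).symm
  intro z hz
  by_cases h2 : z = x
  · rwa [h2]
  by_cases h3 : z = x⁻¹
  · rw [h3]; exact inv_mem h1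
  obtain ⟨t, ht, hzt⟩ := H.translator.exists_left hX hY hz
  exact hX.mem_closure_glue hz ht hzt (fun h => h2 h.2) h3

/-- In general the surgery produces a translator with the help of a copy of the `X`-edge. -/
lemma isTranslator_insert_glue (H : Surgery X Y V v x b) (hX : IsBasis X) (hY : IsBasis Y) {u : F}
    (hu : u ∈ V) (hub : u * b ∈ V) (huc : u ∈ cut X v x) (hubc : u * b ∉ cut X v x) :
    IsTranslator X (surgeryBasis X Y V v x b) (insert (x⁻¹ * v) (glue X v x b '' V)) := by
  have hv : v ∈ glue X v x b '' V := ⟨v, H.left_mem, glue_of_notMem hX.left_notMem_cut⟩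
  have hmono : Subgroup.closure (glue X v x b '' V) ≤
      Subgroup.closure (insert (x⁻¹ * v) (glue X v x b '' V)) :=
    Subgroup.closure_mono (Set.subset_insert _ _)
  refine isTranslator_of_isConn hX (H.isBasis hY) (Or.inr H.one_mem_glue) ?_ ?_ ?_
  · have h1 : x ∈ Subgroup.closure (insert (x⁻¹ * v) (glue X v x b '' V)) := by
      have : v * (x⁻¹ * v)⁻¹ = x := by group
      have h2 := mul_mem (hmono (Subgroup.subset_closure hv))
        (inv_mem (Subgroup.subset_closure (Set.mem_insert (x⁻¹ * v) (glue X v x b '' V))))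
      rwa [this] at h2
    intro z hz
    by_cases h2 : z = x
    · rwa [h2]
    by_cases h3 : z = x⁻¹
    · rw [h3]; exact inv_mem h1
    obtain ⟨t, ht, hzt⟩ := H.translator.exists_left hX hY hz
    exact hmono (hX.mem_closure_glue hz ht hzt (fun h => h2 h.2) h3)
  · refine .of_center v⁻¹ fun s hs => ?_
    have hsub : (glue X v x b '' V)⁻¹ ⊆ (insert (x⁻¹ * v) (glue X v x b '' V))⁻¹ :=
      Set.inv_subset_inv.2 (Set.subset_insert _ _)
    rcases hs with hs | hs
    · have h1 : s = v⁻¹ * x := by rw [← inv_inv s, hs]; group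
      rw [h1]
      refine .single (hsub (by simpa using hv)) H.letter_left ?_
      rw [← h1]; exact Or.inl hs
    · exact (H.linked_inv_glue hX hY hu hub huc hubc _ (by simpa using hv) _ hs).mono hsub
  -- In the `Y'`-tree the added vertex is attached by a `b`-edge to the shifted copy of the far end
  -- of the cut edge.
  · have h2 : x⁻¹ * v * b ∈ glue X v x b '' V :=
      ⟨_, H.right_mem, glue_of_mem (hX.right_mem_cut H.letter_left)⟩
    refine .of_center (x⁻¹ * v * b) fun s hs => ?_
    rcases hs with rfl | hs
    · exact (Linked.single (Set.mem_insert _ _) H.letter_mem (Set.mem_insert_of_mem _ h2)).symm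
    · exact (H.linked_glue hX hY _ h2 _ hs).mono (Set.subset_insert _ _)

lemma glue_eq (hubc : u * b ∉ cut X v x) (huc : u ∈ cut X v x) :
    glue X v x b u = glue X v x b (u * b) := by
  rw [glue_of_mem huc, glue_of_notMem hubc]

/-- The surgery identifies two vertices. -/
lemma encard_glue_lt (H : Surgery X Y V v x b) (hY : IsBasis Y) (hfin : V.Finite) {u : F}
    (hu : u ∈ V) (hub : u * b ∈ V) (huc : u ∈ cut X v x) (hubc : u * b ∉ cut X v x) :
    (glue X v x b '' V).encard < V.encard := by
  have h1 : glue X v x b '' V ⊆ glue X v x b '' (V \ {u}) := by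
    rintro _ ⟨w, hw, rfl⟩
    by_cases hwu : w = u
    · subst hwu
      refine ⟨w * b, ⟨hub, fun h => ?_⟩, by rw [glue_eq hubc huc]⟩
      have : b = 1 := by simpa using h
      exact hY.one_notMem_symm (this ▸ H.letter_right)
    · exact ⟨w, ⟨hw, hwu⟩, rfl⟩
  refine ((Set.encard_le_encard h1).trans (Set.encard_image_le _ _)).trans_lt ?_
  exact (hfin.subset Set.sdiff_subset).encard_lt_encard
    ⟨Set.sdiff_subset, fun h => (h hu).2 rfl⟩

end Surgery

/-! ### Counting vertices -/

lemma encard_sdiff_one {V : Set F} (h : 1 ∈ V) : (V \ {1}).encard + 1 = V.encard :=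
  Set.encard_sdiff_singleton_add_one h

open Classical in
/-- The element of `Y` that is the last letter of `v`, up to inversion. -/
def lastLabel (Y : Set F) (v : F) : F :=
  if (nf Y v).getLast?.getD 1 ∈ Y then (nf Y v).getLast?.getD 1
  else ((nf Y v).getLast?.getD 1)⁻¹

lemma IsBasis.lastLabel_of_append (hY : IsBasis Y) {l : List F} {z : F}
    (h : IsReducedSeq Y (l ++ [z])) :
    (z ∈ Y ∧ lastLabel Y (l ++ [z]).prod = z) ∨ (z⁻¹ ∈ Y ∧ lastLabel Y (l ++ [z]).prod = z⁻¹) := by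
  have hz : z ∈ symm Y := (isReducedSeq_append.1 h).2.1.mem_symm
  have h1 : (nf Y (l ++ [z]).prod).getLast?.getD 1 = z := by
    rw [hY.nf_eq h, List.getLast?_append]; rfl
  rw [lastLabel, h1]
  by_cases h2 : z ∈ Y
  · exact Or.inl ⟨h2, if_pos h2⟩
  · exact Or.inr ⟨hz.resolve_left h2, if_neg h2⟩

/-- Of the two ends of a `Y`-edge, one is obtained by appending a letter to the other. -/
lemma IsBasis.append_or (hY : IsBasis Y) {u y : F} (hy : y ∈ symm Y) :
    IsReducedSeq Y (nf Y u ++ [y]) ∨ IsReducedSeq Y (nf Y (u * y) ++ [y⁻¹]) := by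
  by_cases h : ∀ a ∈ (nf Y u).getLast?, y ≠ a⁻¹
  · exact Or.inl (isReducedSeq_append.2 ⟨hY.nf_reduced u, isReducedSeq_singleton hy,
      fun a ha b hb => by simp at hb; subst hb; exact h a ha⟩)
  · push Not at h
    obtain ⟨a, ha, rfl⟩ := h
    obtain ⟨l, hl⟩ := List.getLast?_eq_some_iff.1 ha
    right
    have h1 := hY.nf_reduced u
    have h2 : u * a⁻¹ = l.prod := by
      nth_rw 1 [← hY.nf_prod u]
      rw [hl]; simp
    rw [hl] at h1
    rw [h2, hY.nf_eq (isReducedSeq_append.1 h1).1, inv_inv]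
    exact h1

lemma IsBasis.exists_lastLabel_eq (hY : IsBasis Y) {V : Set F} {y : F} (hy : y ∈ Y) :
    ∀ u ∈ V, u * y ∈ V → ∃ w ∈ V \ {1}, lastLabel Y w = y ∧
      ((IsReducedSeq Y (nf Y u ++ [y]) ∧ w = u * y) ∨
        (IsReducedSeq Y (nf Y (u * y) ++ [y⁻¹]) ∧ w = u)) := by
  intro u hu huy
  have hne : ∀ l : List F, ∀ z, IsReducedSeq Y (l ++ [z]) → (l ++ [z]).prod ≠ 1 := by
    intro l z h h1
    simpa using hY.eq_nil h h1
  rcases hY.append_or (u := u) (Or.inl hy : y ∈ symm Y) with h | h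
  · have h1 : (nf Y u ++ [y]).prod = u * y := by
      rw [List.prod_append, hY.nf_prod, List.prod_singleton]
    refine ⟨u * y, ⟨huy, ?_⟩, ?_, Or.inl ⟨h, rfl⟩⟩
    · rw [← h1]; exact hne _ _ h
    · rw [← h1]
      rcases hY.lastLabel_of_append h with h2 | h2
      · exact h2.2
      · exact absurd h2.1 (hY.inv_notMem hy)
  · have h1 : (nf Y (u * y) ++ [y⁻¹]).prod = u := by
      rw [List.prod_append, hY.nf_prod, List.prod_singleton, mul_inv_cancel_right]
    refine ⟨u, ⟨hu, ?_⟩, ?_, Or.inr ⟨h, rfl⟩⟩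
    · rw [Set.mem_singleton_iff, ← h1]; exact hne _ _ h
    · rw [← h1]
      rcases hY.lastLabel_of_append h with h2 | h2
      · exact absurd h2.1 (hY.inv_notMem hy)
      · rw [h2.2, inv_inv]

/-- Sending a vertex to the label of its edge towards 1 covers all of `Y`, because every label
occurs in `V`. -/
lemma IsTranslator.encard_le (hX : IsBasis X) (hY : IsBasis Y) {V : Set F}
    (hV : IsTranslator X Y V) : Y.encard ≤ (V \ {1}).encard := by
  have h : Y ⊆ lastLabel Y '' (V \ {1}) := by
    intro y hy
    obtain ⟨u, hu, huy⟩ := hV.exists_right hX hY (Or.inl hy)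
    obtain ⟨w, hw, hwy, -⟩ := hY.exists_lastLabel_eq hy u hu huy
    exact ⟨w, hw, hwy⟩
  exact (Set.encard_le_encard h).trans (Set.encard_image_le _ _)

/-- In a translator of the least possible cardinality, there is only one edge of each label. -/
lemma IsTranslator.eq_of_encard (hX : IsBasis X) (hY : IsBasis Y) {V : Set F}
    (hV : IsTranslator X Y V) (hfin : Y.Finite) (hcard : (V \ {1}).encard = Y.encard) {y u w : F}
    (hy : y ∈ symm Y) (hu : u ∈ V) (huy : u * y ∈ V) (hw : w ∈ V) (hwy : w * y ∈ V) : u = w := by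
  have hVfin : (V \ {1}).Finite := by
    rw [← Set.encard_lt_top_iff, hcard]; exact hfin.encard_lt_top
  -- A surjection between finite sets of equal size is injective.
  have hinj : Set.InjOn (lastLabel Y) (V \ {1}) := by
    refine Set.injOn_of_ncard_image_eq ?_ hVfin
    refine le_antisymm (Set.ncard_image_le hVfin) ?_
    have h1 : (V \ {1}).ncard = Y.ncard := by rw [Set.ncard, hcard, Set.ncard]
    rw [h1]
    refine Set.ncard_le_ncard ?_ (hVfin.image _)
    intro y hy
    obtain ⟨u, hu, huy⟩ := hV.exists_right hX hY (Or.inl hy)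
    obtain ⟨w, hw, hwy, -⟩ := hY.exists_lastLabel_eq hy u hu huy
    exact ⟨w, hw, hwy⟩
  have key : ∀ y ∈ Y, ∀ u ∈ V, u * y ∈ V → ∀ w ∈ V, w * y ∈ V → u = w := by
    intro y hy u hu huy w hw hwy
    obtain ⟨s, hs, hsy, hs'⟩ := hY.exists_lastLabel_eq hy u hu huy
    obtain ⟨t, ht, hty, ht'⟩ := hY.exists_lastLabel_eq hy w hw hwy
    have hst : s = t := hinj hs ht (hsy.trans hty.symm)
    subst hst
    have hlast : ∀ p q : F, IsReducedSeq Y (nf Y p ++ [y]) → IsReducedSeq Y (nf Y q ++ [y⁻¹]) →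
        p * y ≠ q * y⁻¹ := by
      intro p q hp hq hpq
      have h1 := hY.nf_eq hp
      have h2 := hY.nf_eq hq
      rw [List.prod_append, hY.nf_prod, List.prod_singleton] at h1 h2
      rw [hpq, h2] at h1
      have h3 := congrArg List.getLast? h1
      simp only [List.getLast?_append, List.getLast?_singleton, Option.some_or,
        Option.some.injEq] at h3
      exact hY.inv_ne (Or.inl hy) h3
    rcases hs' with ⟨h1, rfl⟩ | ⟨h1, rfl⟩ <;> rcases ht' with ⟨h2, h3⟩ | ⟨h2, h3⟩
    · exact mul_right_cancel h3
    · exact absurd (by rw [h3, mul_inv_cancel_right]) (hlast _ _ h1 h2)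
    · exact absurd (by rw [← h3, mul_inv_cancel_right]) (hlast _ _ h2 h1)
    · exact h3
  rcases hy with hy | hy
  · exact key y hy u hu huy w hw hwy
  · have := key _ hy _ huy (by simpa) _ hwy (by simpa)
    exact mul_right_cancel this

/-- If there is at most one edge of each label, then the translator is as small as possible. -/
lemma IsTranslator.encard_le_of_unique (hX : IsBasis X) (hY : IsBasis Y) {V : Set F}
    (hV : IsTranslator X Y V)
    (h : ∀ y ∈ symm Y, ∀ u ∈ V, u * y ∈ V → ∀ w ∈ V, w * y ∈ V → u = w) :
    (V \ {1}).encard ≤ Y.encard := by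
  obtain ⟨h1, -, -, hYV⟩ := (isTranslator_iff hX hY).1 hV
  have hpar : ∀ v ∈ V \ {1}, ∃ l z, nf Y v = l ++ [z] ∧ l.prod ∈ V ∧ v = l.prod * z := by
    rintro v ⟨hv, hv1⟩
    have h2 := hY.nf_prod v
    rcases List.eq_nil_or_concat (nf Y v) with h3 | ⟨l, z, h3⟩
    · rw [h3] at h2; exact absurd h2.symm hv1
    · rw [List.concat_eq_append] at h3
      have h4 := hYV.append_mem h1 (l := l) (m := [z]) (h3 ▸ hY.nf_reduced v)
        (by rw [← h3, h2, one_mul]; exact hv)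
      refine ⟨l, z, h3, by simpa using h4, ?_⟩
      rw [h3] at h2
      simpa using h2.symm
  refine Set.encard_le_encard_of_injOn (f := lastLabel Y) ?_ ?_
  · intro v hv
    obtain ⟨l, z, h2, -, -⟩ := hpar v hv
    have h3 := hY.nf_reduced v
    rw [h2] at h3
    have h4 := hY.lastLabel_of_append h3
    rw [← h2, hY.nf_prod] at h4
    rcases h4 with h4 | h4 <;> exact h4.2 ▸ h4.1
  · intro v hv w hw hvw
    obtain ⟨l, z, h2, h3, h4⟩ := hpar v hv
    obtain ⟨m, t, h5, h6, h7⟩ := hpar w hw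
    have hl := hY.nf_reduced v
    rw [h2] at hl
    have hm := hY.nf_reduced w
    rw [h5] at hm
    have h8 := hY.lastLabel_of_append hl
    have h9 := hY.lastLabel_of_append hm
    rw [← h2, hY.nf_prod] at h8
    rw [← h5, hY.nf_prod] at h9
    have hz := (isReducedSeq_append.1 hl).2.1.mem_symm
    have same : z = t → v = w := by
      rintro rfl
      rw [h4, h7, h z hz _ h3 (h4 ▸ hv.1) _ h6 (h7 ▸ hw.1)]
    -- Uniqueness would make `v` and `w` each the predecessor of the other on the way to 1, which
    -- contradicts their lengths.
    have opp : z = t⁻¹ → v = w := by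
      rintro rfl
      exfalso
      have h10 : m.prod = v := h t ((inv_inv t) ▸ inv_mem_symm hz) _ h6 (h7 ▸ hw.1) _ hv.1
        (by rw [h4, inv_mul_cancel_right]; exact h3)
      have h11 : w = l.prod := by rw [h7, h10, h4, inv_mul_cancel_right]
      have h12 := congrArg List.length h2
      have h13 := congrArg List.length h5
      rw [← h10, hY.nf_eq (isReducedSeq_append.1 hm).1] at h12
      rw [h11, hY.nf_eq (isReducedSeq_append.1 hl).1] at h13
      simp only [List.length_append, List.length_singleton] at h12 h13
      omega
    rcases h8 with ⟨-, h8⟩ | ⟨-, h8⟩ <;> rcases h9 with ⟨-, h9⟩ | ⟨-, h9⟩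
    · exact same (by rw [← h8, hvw, h9])
    · exact opp (by rw [← h8, hvw, h9])
    · exact opp (by rw [← h9, ← hvw, h8, inv_inv])
    · exact same (inv_injective (by rw [← h8, hvw, h9]))

/-! ### Weights -/

section
variable {P Q : F → F ⊕ F → Prop}

lemma count_mono (h : ∀ u s, P u s → Q u s) (u : F) (l : List (F ⊕ F)) :
    count P u l ≤ count Q u l := by
  induction l generalizing u with
  | nil => exact le_rfl
  | cons s l ih =>
    rw [count, count]
    refine add_le_add ?_ (ih _)
    by_cases h1 : P u s
    · rw [if_pos h1, if_pos (h u s h1)]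
    · rw [if_neg h1]; exact Nat.zero_le _

lemma move_swap (u : F) (s : F ⊕ F) : move u⁻¹ s.swap = (move u s)⁻¹ := by
  rcases s with x | y <;> simp [move]

lemma count_swap (h : ∀ u s, Q u⁻¹ s.swap ↔ P u s) (u : F) (l : List (F ⊕ F)) :
    count Q u⁻¹ (l.map Sum.swap) = count P u l := by
  induction l generalizing u with
  | nil => rfl
  | cons s l ih =>
    rw [List.map_cons, count, count, move_swap, ih]
    by_cases hP : P u s
    · rw [if_pos hP, if_pos ((h u s).2 hP)]
    · rw [if_neg hP, if_neg (mt (h u s).1 hP)]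

end

section
omit [Group F]
lemma lefts_swap (l : List (F ⊕ F)) : lefts (l.map Sum.swap) = rights l := by
  induction l with
  | nil => rfl
  | cons s l ih => rcases s with x | y <;> simp [ih]

lemma rights_swap (l : List (F ⊕ F)) : rights (l.map Sum.swap) = lefts l := by
  induction l with
  | nil => rfl
  | cons s l ih => rcases s with x | y <;> simp [ih]
end

lemma Stays.swap {V : Set F} {u : F} {l : List (F ⊕ F)} (h : Stays V u l) :
    Stays V⁻¹ u⁻¹ (l.map Sum.swap) := by
  induction l generalizing u with
  | nil => simpa [Stays] using h
  | cons s l ih =>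
    refine ⟨by simpa using h.1, ?_⟩
    rw [move_swap]
    exact ih h.2

/-- The same walks serve for the dual translator, so both local minimality conditions compare
weights of the same walks. -/
lemma Realizes.swap {V : Set F} {r : Word F} {v : F} {l : List (F ⊕ F)}
    (h : Realizes X Y V r v l) : Realizes Y X V⁻¹ r v⁻¹ (l.map Sum.swap) := by
  have hc := h.closed
  refine ⟨h.stays.swap, ?_, ?_, ?_, ?_, ?_, ?_⟩
  · rw [lefts_swap, rights_swap]
    nth_rw 2 [← hc]
    group
  · rw [lefts_swap]; exact h.rights_mem
  · rw [rights_swap]; exact h.lefts_mem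
  · rw [lefts_swap]; exact h.rights_length
  · rw [rights_swap]; exact h.lefts_length
  · rw [rights_swap]
    have h1 : (lefts l).prod = v * (rights l).prod * v⁻¹ := by
      nth_rw 2 [← hc]
      group
    rcases h.spells with ⟨g, rfl, rfl, rfl⟩ | rfl
    · exact Or.inl ⟨_, rfl, inv_one, by simpa using h1⟩
    · refine Or.inr ?_
      congr 1
      rw [ConjClasses.mk_eq_mk_iff_isConj, isConj_iff]
      exact ⟨v, h1.symm⟩

/-- The number of steps with the property `P` in the given closed walks. -/
def weight (R : Finset (Word F)) (base : Word F → F) (walk : Word F → List (F ⊕ F))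
    (P : F → F ⊕ F → Prop) : ℕ := ∑ r ∈ R, count P (base r) (walk r)

lemma weight_mono {R : Finset (Word F)} {base : Word F → F} {walk : Word F → List (F ⊕ F)}
    {P Q : F → F ⊕ F → Prop} (h : ∀ u s, P u s → Q u s) :
    weight R base walk P ≤ weight R base walk Q :=
  Finset.sum_le_sum fun _ _ => count_mono h _ _

lemma weight_swap_onLeft (R : Finset (Word F)) (base : Word F → F)
    (walk : Word F → List (F ⊕ F)) (s a : F) :
    weight R (fun r => (base r)⁻¹) (fun r => (walk r).map Sum.swap) (OnLeft s a) =
      weight R base walk (OnRight s⁻¹ a) := by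
  refine Finset.sum_congr rfl fun r _ => count_swap (fun u t => ?_) _ _
  have h1 : u⁻¹ = a⁻¹ * s ↔ u = s⁻¹ * a := by
    rw [inv_eq_iff_eq_inv]; simp
  rcases t with t | t <;> simp [OnLeft, OnRight, h1, inv_eq_iff_eq_inv]

lemma weight_swap_onRight (R : Finset (Word F)) (base : Word F → F)
    (walk : Word F → List (F ⊕ F)) (s a : F) :
    weight R (fun r => (base r)⁻¹) (fun r => (walk r).map Sum.swap) (OnRight s⁻¹ a) =
      weight R base walk (OnLeft s a) := by
  refine Finset.sum_congr rfl fun r _ => count_swap (fun u t => ?_) _ _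
  have h1 : u⁻¹ = s⁻¹ * a ↔ u = a⁻¹ * s := by
    rw [inv_eq_iff_eq_inv]; simp
  rcases t with t | t <;> simp [OnLeft, OnRight, h1, inv_eq_iff_eq_inv]

lemma onLeft_flip (v x : F) : OnLeft (x⁻¹ * v) x⁻¹ = OnLeft v x := by
  funext u s
  simp only [OnLeft, inv_inv, mul_inv_cancel_left, eq_iff_iff]
  tauto

lemma Surgery.h_add_le {V : Set F} {v x b : F} (H : Surgery X Y V v x b) (hX : IsBasis X)
    (hY : IsBasis Y) {R : Finset (Word F)} {base : Word F → F} {walk : Word F → List (F ⊕ F)}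
    (hw : ∀ r, Realizes X Y V r (base r) (walk r)) :
    h R (surgeryBasis X Y V v x b) + weight R base walk (Crosses X v x b) ≤
      h R Y + weight R base walk (OnLeft v x) := by
  unfold h weight
  rw [← Finset.sum_add_distrib, ← Finset.sum_add_distrib]
  exact Finset.sum_le_sum fun r _ => H.length_le hX hY (hw r)

/-- Local minimality forbids a surgery that saves more letters than it inserts. -/
lemma Surgery.weight_le {V : Set F} {v x b : F} (H : Surgery X Y V v x b) (hX : IsBasis X)
    (hY : IsBasis Y) {R : Finset (Word F)} {base : Word F → F} {walk : Word F → List (F ⊕ F)}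
    (hw : ∀ r, Realizes X Y V r (base r) (walk r)) (hmin : IsLocalMin R Y) :
    weight R base walk (Crosses X v x b) ≤ weight R base walk (OnLeft v x) := by
  have h1 := H.h_add_le hX hY (R := R) hw
  have h2 := hmin _ (H.isBasis hY) H.isWhiteheadTransform
  omega

lemma Surgery.h_eq {V : Set F} {v x b : F} (H : Surgery X Y V v x b) (hX : IsBasis X)
    (hY : IsBasis Y) {R : Finset (Word F)} {base : Word F → F} {walk : Word F → List (F ⊕ F)}
    (hw : ∀ r, Realizes X Y V r (base r) (walk r)) (hmin : IsLocalMin R Y)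
    (hle : weight R base walk (OnLeft v x) ≤ weight R base walk (Crosses X v x b)) :
    h R (surgeryBasis X Y V v x b) = h R Y := by
  have h1 := H.h_add_le hX hY (R := R) hw
  have h2 := hmin _ (H.isBasis hY) H.isWhiteheadTransform
  omega

/-! ### Innermost edges -/

/-- The `X`-edge from `v` to `x⁻¹ * v` is on exactly one square, spanned by it and the letter `a`
of `Y^{±1}`. -/
structure Inner (X Y V : Set F) (v x a : F) : Prop where
  letter_left : x ∈ symm X
  left_mem : v ∈ V
  right_mem : x⁻¹ * v ∈ V
  letter_right : a ∈ symm Y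
  left_mul_mem : v * a ∈ V
  right_mul_mem : x⁻¹ * v * a ∈ V
  unique : ∀ z ∈ symm Y, v * z ∈ V → x⁻¹ * v * z ∈ V → z = a

lemma Inner.flip {V : Set F} {v x a : F} (h : Inner X Y V v x a) :
    Inner X Y V (x⁻¹ * v) x⁻¹ a where
  letter_left := inv_mem_symm h.letter_left
  left_mem := h.right_mem
  right_mem := by simpa using h.left_mem
  letter_right := h.letter_right
  left_mul_mem := h.right_mul_mem
  right_mul_mem := by simpa using h.left_mul_mem
  unique := fun z hz h1 h2 => h.unique z hz (by simpa using h2) h1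

/-- Beyond each edge of a finite convex set there is a vertex with only one neighbour. -/
lemma IsBasis.exists_leaf (hY : IsBasis Y) {C : Set F} (hC : Conv Y C) (hfin : C.Finite) {c y : F}
    (hc : c ∈ C) (hcy : c * y ∈ C) (hy : y ∈ symm Y) :
    ∃ u ∈ C, c⁻¹ * u ∈ side Y y ∧ ∃ z ∈ symm Y, u * z ∈ C ∧ ∀ t ∈ symm Y, u * t ∈ C → t = z := by
  have hne : {u ∈ C | c⁻¹ * u ∈ side Y y}.Nonempty :=
    ⟨c * y, hcy, by rw [inv_mul_cancel_left]; exact hY.self_mem_side hy⟩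
  obtain ⟨u, ⟨hu, hus⟩, hmax⟩ := (hfin.subset (Set.sep_subset C _)).exists_maximalFor
    (fun u => (nf Y (c⁻¹ * u)).length) _ hne
  have h1 := hY.nf_reduced (c⁻¹ * u)
  have h2 := hY.nf_prod (c⁻¹ * u)
  rcases List.eq_nil_or_concat (nf Y (c⁻¹ * u)) with h3 | ⟨m, t, h3⟩
  · rw [side, Set.mem_ofPred_eq, h3] at hus; simp at hus
  rw [List.concat_eq_append] at h3
  refine ⟨u, hu, hus, t⁻¹, ?_, ?_, ?_⟩
  · rw [h3] at h1
    exact inv_mem_symm (isReducedSeq_append.1 h1).2.1.mem_symm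
  · have h4 := hC.append_mem hc (l := m) (m := [t]) (h3 ▸ h1)
      (by rw [← h3, h2, mul_inv_cancel_left]; exact hu)
    have h5 : u * t⁻¹ = c * m.prod := by
      rw [h3, List.prod_append, List.prod_singleton] at h2
      rw [eq_mul_inv_of_mul_eq h2]; group
    rwa [h5]
  · intro z hz huz
    by_contra hzt
    have h4 : IsReducedSeq Y (nf Y (c⁻¹ * u) ++ [z]) := by
      refine isReducedSeq_append.2 ⟨h1, isReducedSeq_singleton hz, fun a ha b hb => ?_⟩
      rw [h3] at ha
      simp only [List.getLast?_append, List.getLast?_singleton, Option.some_or, Option.mem_def,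
        Option.some.injEq, List.head?_cons] at ha hb
      rw [← ha, ← hb]; exact hzt
    have h5 : (nf Y (c⁻¹ * u) ++ [z]).prod = c⁻¹ * (u * z) := by
      rw [List.prod_append, h2, List.prod_singleton, mul_assoc]
    have h6 : u * z ∈ {u ∈ C | c⁻¹ * u ∈ side Y y} := by
      refine ⟨huz, ?_⟩
      rw [← h5, hY.mem_side_of_reduced h4, List.head?_append, show _ = _ from hus]; rfl
    have h7 : (nf Y (c⁻¹ * (u * z))).length ≤ (nf Y (c⁻¹ * u)).length :=
      hmax h6 (by
        change (nf Y (c⁻¹ * u)).length ≤ (nf Y (c⁻¹ * (u * z))).length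
        rw [← h5, hY.nf_eq h4]; simp)
    rw [← h5, hY.nf_eq h4] at h7
    simp at h7

/-- The inverses of the initial vertices of the edges with label `y` in `V`. -/
lemma conv_edges {V : Set F} (hV : Conv X V⁻¹) (y : F) : Conv X {s | s ∈ V⁻¹ ∧ y⁻¹ * s ∈ V⁻¹} :=
  hV.inter (hV.preimage_mul y⁻¹)

/-- The `y`-edges of `V` form a finite `X`-tree whose edges are squares; a leaf is a `y`-edge on
exactly one square. The leaf is sought beyond the given square so that its side of the cut is known.
-/
lemma exists_inner_of_edge (hX : IsBasis X) {V : Set F} (hV : Conv X V⁻¹) (hfin : V.Finite)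
    {y c x : F} (hy : y ∈ symm Y) (hx : x ∈ symm X) (hc : c⁻¹ ∈ V) (hyc : c⁻¹ * y ∈ V)
    (hcx : x⁻¹ * c⁻¹ ∈ V) (hycx : x⁻¹ * c⁻¹ * y ∈ V) :
    ∃ s z, Inner Y X V⁻¹ s y z ∧ c⁻¹ * s ∈ side X x := by
  have hfin' : {s | s ∈ V⁻¹ ∧ y⁻¹ * s ∈ V⁻¹}.Finite :=
    (hfin.inv).subset fun s hs => hs.1
  obtain ⟨s, hs, h1, z, hz, hsz, h2⟩ := hX.exists_leaf (conv_edges hV y) hfin' (c := c) (y := x)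
    ⟨hc, by simpa using hyc⟩ ⟨by simpa using hcx, by simpa [mul_assoc] using hycx⟩ hx
  exact ⟨s, z, ⟨hy, hs.1, hs.2, hz, hsz.1, by simpa [mul_assoc] using hsz.2,
    fun t ht h3 h4 => h2 t ht ⟨h3, by simpa [mul_assoc] using h4⟩⟩, h1⟩

/-- Surgery along an innermost `X`-edge; among the `Y`-edges that cross the cut there is an
innermost one. -/
lemma Inner.exists_surgery {V : Set F} {v x a : F} (h : Inner X Y V v x a) (hX : IsBasis X)
    (hY : IsBasis Y) (hV : IsTranslator X Y V) (hfin : V.Finite) (h1 : 1 ∉ cut X v x) :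
    ∃ b u s z, Surgery X Y V v x b ∧ u ∈ V ∧ u * b ∈ V ∧ u ∈ cut X v x ∧ u * b ∉ cut X v x ∧
      Inner Y X V⁻¹ s a z ∧ ∀ p t, OnRight s⁻¹ a p t → Crosses X v x b p t := by
  obtain ⟨-, -, hXV, hYV⟩ := (isTranslator_iff hX hY).1 hV
  -- If `z`-edges started on both sides, convexity of this family would give a `z`-square on the cut
  -- edge, whose only square has letter `a`.
  have hsplit : ∀ z ∈ symm Y, z ≠ a → ∀ p ∈ V, p * z ∈ V → ∀ q ∈ V, q * z ∈ V →
      p ∈ cut X v x → q ∈ cut X v x := by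
    intro z hz hza p hp hpz q hq hqz hpc
    by_contra hqc
    have h2 := hX.edge_mem (conv_edges hXV z) (v := v⁻¹) (y := x) (p := q⁻¹) (q := p⁻¹)
      ⟨by simpa using hq, by simpa using hqz⟩ ⟨by simpa using hp, by simpa using hpz⟩
      (by rw [inv_inv]; exact hqc) (by rw [inv_inv]; exact hpc)
    refine hza (h.unique z hz (by simpa using h2.1.2) ?_)
    simpa [mul_assoc] using h2.2.2
  -- The ends of the `a`-edges are the starts of the `a⁻¹`-edges, so `hsplit` for `a⁻¹` puts them
  -- all on one side. That side decides whether `b` is `a` or `a⁻¹`.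
  by_cases hcase : ∀ w ∈ V, w * a ∈ V → w * a ∉ cut X v x
  · obtain ⟨s, z, hs, hsc⟩ := exists_inner_of_edge hX hXV hfin (y := a) (c := v⁻¹) (x := x)
      h.letter_right h.letter_left (by simpa using h.left_mem) (by simpa using h.left_mul_mem)
      (by simpa using h.right_mem) (by simpa using h.right_mul_mem)
    rw [inv_inv] at hsc
    have hsc' : s⁻¹ ∈ cut X v x := by simpa [cut] using hsc
    have hsa : s⁻¹ * a ∉ cut X v x :=
      hcase _ (by simpa using hs.left_mem) (by simpa using hs.right_mem)
    refine ⟨a, x⁻¹ * v, s, z, ⟨hV, h.left_mem, h.letter_left, h.right_mem, h1, h.letter_right,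
      fun y hy hya _ => hsplit y hy hya, fun u hu hua huc => absurd huc (hcase u hu hua)⟩,
      h.right_mem, h.right_mul_mem, hX.right_mem_cut h.letter_left,
      hcase _ h.right_mem h.right_mul_mem, hs, ?_⟩
    rintro p t (⟨rfl, rfl⟩ | ⟨rfl, rfl⟩)
    · exact Or.inl ⟨rfl, hsc', hsa⟩
    · exact Or.inr ⟨rfl, hsa, by rwa [mul_inv_cancel_right]⟩
  · push Not at hcase
    obtain ⟨w, hw, hwa, hwc⟩ := hcase
    have hall : ∀ u ∈ V, u * a ∈ V → u * a ∈ cut X v x := fun u hu hua =>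
      hsplit a⁻¹ (inv_mem_symm h.letter_right) (hY.inv_ne h.letter_right) (w * a) hwa (by simpa)
        (u * a) hua (by simpa) hwc
    have hsurg : Surgery X Y V v x a⁻¹ := by
      refine ⟨hV, h.left_mem, h.letter_left, h.right_mem, h1, inv_mem_symm h.letter_right,
        fun y hy _ hya => hsplit y hy (by simpa using hya), fun u hu hua _ => ?_⟩
      have := hall (u * a⁻¹) hua (by simpa)
      simpa using this
    obtain ⟨s, z, hs, hsc⟩ := exists_inner_of_edge hX hXV hfin (y := a) (c := v⁻¹ * x) (x := x⁻¹)
      h.letter_right (inv_mem_symm h.letter_left) (by simpa using h.right_mem)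
      (by simpa using h.right_mul_mem) (by simpa using h.left_mem)
      (by simpa using h.left_mul_mem)
    have hsc' : s⁻¹ ∉ cut X v x := by
      have := (hX.side_compl (g := v * s) h.letter_left).2 (by simpa [mul_assoc] using hsc)
      simpa [cut] using this
    have hsa : s⁻¹ * a ∈ cut X v x :=
      hall _ (by simpa using hs.left_mem) (by simpa using hs.right_mem)
    refine ⟨a⁻¹, v * a, s, z, hsurg, h.left_mul_mem, by simpa using h.left_mem,
      hall _ h.left_mem h.left_mul_mem, by simpa using hX.left_notMem_cut, hs, ?_⟩
    rintro p t (⟨rfl, rfl⟩ | ⟨rfl, rfl⟩)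
    · exact Or.inr ⟨by rw [inv_inv], hsc', by rwa [inv_inv]⟩
    · exact Or.inl ⟨rfl, hsa, by rwa [mul_inv_cancel_right]⟩

/-- Justifies reversing the cut edge so that 1 lies in the part that is not moved. -/
lemma IsBasis.one_notMem_cut_or (hX : IsBasis X) {v x : F} (hx : x ∈ symm X) :
    1 ∉ cut X v x ∨ 1 ∉ cut X (x⁻¹ * v) x⁻¹ := by
  simp only [cut, Set.mem_ofPred_eq, inv_one, mul_one]
  by_contra! h
  exact (hX.side_compl hx).2 h.2 h.1

/-- An innermost `X`-edge leads to an innermost `Y`-edge that is not heavier; if it is not lighter,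
then surgery does not change the total length. -/
lemma Inner.next {V : Set F} {v x a : F} (h : Inner X Y V v x a) (hX : IsBasis X)
    (hY : IsBasis Y) (hV : IsTranslator X Y V) (hfin : V.Finite) {R : Finset (Word F)}
    {base : Word F → F} {walk : Word F → List (F ⊕ F)}
    (hw : ∀ r, Realizes X Y V r (base r) (walk r)) (hmin : IsLocalMin R Y) :
    ∃ s z, Inner Y X V⁻¹ s a z ∧
      weight R base walk (OnRight s⁻¹ a) ≤ weight R base walk (OnLeft v x) ∧
      (weight R base walk (OnLeft v x) ≤ weight R base walk (OnRight s⁻¹ a) →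
        ∃ Y' V', IsBasis Y' ∧ IsWhiteheadTransform Y Y' ∧ WhiteheadGraph.h R Y' =
          WhiteheadGraph.h R Y ∧ IsTranslator X Y' V' ∧ V'.encard < V.encard) := by
  wlog h1 : 1 ∉ cut X v x generalizing v x
  · have h2 := this h.flip ((hX.one_notMem_cut_or h.letter_left).resolve_left h1)
    rwa [onLeft_flip] at h2
  obtain ⟨b, u, s, z, H, hu, hub, huc, hubc, hs, hcross⟩ := h.exists_surgery hX hY hV hfin h1
  have h2 := weight_mono (R := R) (base := base) (walk := walk) hcross
  refine ⟨s, z, hs, h2.trans (H.weight_le hX hY hw hmin), fun h3 => ?_⟩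
  refine ⟨_, _, H.isBasis hY, H.isWhiteheadTransform, H.h_eq hX hY hw hmin (h3.trans h2),
    H.isTranslator_glue hX hY hu hub huc hubc h.left_mul_mem
      (by simpa [mul_assoc] using h.right_mul_mem) ?_,
    H.encard_glue_lt hY hfin hu hub huc hubc⟩
  intro h4
  have : a = 1 := by simpa using h4
  exact hY.one_notMem_symm (this ▸ h.letter_right)

/-- If some label occurs on two edges of a finite translator, then the second basis has a Whitehead
transform of the same total length with a smaller translator. -/
lemma IsTranslator.exists_smaller (hX : IsBasis X) (hY : IsBasis Y) {V : Set F}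
    (hV : IsTranslator X Y V) (hfin : V.Finite) {R : Finset (Word F)} (hXmin : IsLocalMin R X)
    (hYmin : IsLocalMin R Y) {y u w : F} (hy : y ∈ symm Y) (hu : u ∈ V) (huy : u * y ∈ V)
    (hw : w ∈ V) (hwy : w * y ∈ V) (huw : u ≠ w) :
    ∃ Y' V', IsBasis Y' ∧ IsWhiteheadTransform Y Y' ∧ h R Y' = h R Y ∧ IsTranslator X Y' V' ∧
      V'.encard < V.encard := by
  choose base walk hwalk using fun r => hV.exists_realizes hX hY r
  have hV' := hV.inv hX hY
  have hwalk' : ∀ r, Realizes Y X V⁻¹ r (base r)⁻¹ ((walk r).map Sum.swap) :=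
    fun r => (hwalk r).swap
  have hXV := ((isTranslator_iff hX hY).1 hV).2.2.1
  -- The dual of `Inner.next`, which uses local minimality of `X`.
  have dual : ∀ s a z, Inner Y X V⁻¹ s a z → ∃ v x c, Inner X Y V v x c ∧
      weight R base walk (OnLeft v x) ≤ weight R base walk (OnRight s⁻¹ a) := by
    intro s a z hs
    obtain ⟨v, c, h1, h2, -⟩ := hs.next hY hX hV' hfin.inv hwalk' hXmin
    rw [weight_swap_onLeft, weight_swap_onRight] at h2
    exact ⟨v, z, c, by simpa using h1, h2⟩
  have hne : ∃ e : F × F, ∃ c, Inner X Y V e.1 e.2 c := by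
    -- Two parallel `y`-edges are joined by an `X`-path of `y`-edges; its first step is a square, so
    -- the tree of `y`-edges has a leaf.
    obtain ⟨x, hx, hxs⟩ := hX.exists_mem_side (g := u * w⁻¹) (by
      rw [Ne, mul_inv_eq_one]; exact huw)
    obtain ⟨l, hl, hlp⟩ := hX.exists_of_mem_side hxs
    have h1 := conv_edges hXV y u⁻¹ ⟨by simpa using hu, by simpa using huy⟩ x l hl
      (by rw [← hlp]; exact ⟨by simpa using hw, by simpa using hwy⟩)
    obtain ⟨s, z, hs, -⟩ := exists_inner_of_edge hX hXV hfin (y := y) (c := u⁻¹) (x := x) hy hx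
      (by simpa using hu) (by simpa using huy) (by simpa using h1.1)
      (by simpa [mul_assoc] using h1.2)
    obtain ⟨v, x, c, hv, -⟩ := dual s y z hs
    exact ⟨(v, x), c, hv⟩
  -- Passing to an innermost `Y`-edge and back cannot decrease the minimal weight, so the first
  -- passage does not decrease it either.
  obtain ⟨⟨v, x⟩, ⟨a, hv⟩, hmin⟩ := exists_minimalFor_of_wellFoundedLT
    (fun e : F × F => ∃ c, Inner X Y V e.1 e.2 c)
    (fun e => weight R base walk (OnLeft e.1 e.2)) hne
  obtain ⟨s, z, hs, h1, h2⟩ := hv.next hX hY hV hfin hwalk hYmin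
  obtain ⟨v', x', c, hv', h3⟩ := dual s a z hs
  refine h2 (le_trans ?_ h3)
  exact hmin (j := (v', x')) ⟨c, hv'⟩ (h3.trans h1)

/-! ### Valences -/

/-- The letters of the edges at `v` in the right Cayley graph on `V`. -/
def links (Y V : Set F) (v : F) : Set F := {y | y ∈ symm Y ∧ v * y ∈ V}

lemma IsBasis.encard_right (hY : IsBasis Y) (V : Set F) (v : F) :
    {w ∈ V | (rightCayley Y).Adj v w}.encard = (links Y V v).encard := by
  have : {w ∈ V | (rightCayley Y).Adj v w} = (v * ·) '' links Y V v := by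
    ext w
    simp only [Set.mem_ofPred_eq, hY.rightCayley_adj, links, Set.mem_image]
    constructor
    · exact fun ⟨h1, h2⟩ => ⟨_, ⟨h2, by simpa⟩, by simp⟩
    · rintro ⟨y, ⟨h1, h2⟩, rfl⟩
      exact ⟨h2, by simpa⟩
  rw [this, (mul_right_injective v).encard_image]

lemma valence_eq (hX : IsBasis X) (hY : IsBasis Y) (V : Set F) (v : F) :
    valence X Y V v = (links X V⁻¹ v⁻¹).encard + (links Y V v).encard := by
  rw [valence, hY.encard_right, ← hX.encard_right]
  congr 1
  have : {w ∈ V⁻¹ | (rightCayley X).Adj v⁻¹ w} = (·⁻¹) '' {w ∈ V | (leftCayley X).Adj v w} := by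
    ext w
    simp only [Set.image_inv_eq_inv, Set.mem_ofPred_eq, Set.mem_inv, hX.leftCayley_adj, inv_inv]
  rw [this, inv_injective.encard_image]

/-- Takes the first edge on the path to 1; unless it arrives at once, the next vertex has a second
edge, continuing the path. -/
lemma IsBasis.exists_link (hY : IsBasis Y) {V : Set F} (h1 : 1 ∈ V) (hV : Conv Y V) {v : F}
    (hv : v ∈ V) (hv1 : v ≠ 1) :
    ∃ y ∈ links Y V v, v * y = 1 ∨ (v * y ≠ 1 ∧ ∃ z ∈ links Y V (v * y), z ≠ y⁻¹) := by
  have h2 := hY.nf_reduced v⁻¹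
  have h3 := hY.nf_prod v⁻¹
  have h4 : v * (nf Y v⁻¹).prod = 1 := by rw [h3, mul_inv_cancel]
  cases h5 : nf Y v⁻¹ with
  | nil => rw [h5] at h3; exact absurd (by simpa using h3.symm) hv1
  | cons y l =>
    rw [h5] at h2 h4
    have hvy : v * y ∈ V := hV v hv y l h2 (by rw [h4]; exact h1)
    refine ⟨y, ⟨h2.mem_symm, hvy⟩, ?_⟩
    cases l with
    | nil => exact Or.inl (by simpa using h4)
    | cons z l =>
      rw [List.prod_cons, ← mul_assoc] at h4
      refine Or.inr ⟨fun h => ?_, z, ⟨h2.tail.mem_symm, hV _ hvy z l h2.tail ?_⟩,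
        (isReducedSeq_cons_cons.1 h2).2.1⟩
      · rw [h, one_mul] at h4
        simpa using hY.eq_nil h2.tail h4
      · rw [h4]; exact h1

lemma IsTranslator.links_nonempty (hX : IsBasis X) (hY : IsBasis Y) {V : Set F}
    (hV : IsTranslator X Y V) {v : F} (hv : v ∈ V) (hv1 : v ≠ 1) : 1 ≤ (links Y V v).encard := by
  obtain ⟨h1, -, -, hYV⟩ := (isTranslator_iff hX hY).1 hV
  obtain ⟨y, hy, -⟩ := hY.exists_link h1 hYV hv hv1
  rw [Set.one_le_encard_iff_nonempty]
  exact ⟨y, hy⟩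

lemma IsTranslator.three_le_valence (hX : IsBasis X) (hY : IsBasis Y) {V : Set F}
    (hV : IsTranslator X Y V) {v y z : F} (hv : v ∈ V) (hv1 : v ≠ 1) (hy : y ∈ links Y V v)
    (hz : z ∈ links Y V v) (hyz : y ≠ z) : v ∈ branchSet X Y V := by
  refine ⟨⟨hv, hv1⟩, ?_⟩
  rw [valence_eq hX hY]
  have h1 := (hV.inv hX hY).links_nonempty hY hX (v := v⁻¹) (by simpa) (by simpa)
  have h2 : 2 ≤ (links Y V v).encard := by
    rw [← Set.encard_pair hyz]
    exact Set.encard_le_encard (by rintro _ (rfl | rfl) <;> assumption)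
  calc (3 : ℕ∞) = 1 + 2 := by norm_num
    _ ≤ _ := add_le_add h1 h2

lemma branchSet_inv (hX : IsBasis X) (hY : IsBasis Y) (V : Set F) :
    branchSet Y X V⁻¹ = (branchSet X Y V)⁻¹ := by
  ext v
  simp only [branchSet, Set.mem_ofPred_eq, Set.mem_inv, Set.mem_sdiff, Set.mem_singleton_iff,
    inv_eq_one, valence_eq hY hX, valence_eq hX hY, inv_inv, add_comm]

/-- If no vertex other than `1` has valence three, then the translator is a star. -/
lemma IsTranslator.sdiff_subset (hX : IsBasis X) (hY : IsBasis Y) {V : Set F}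
    (hV : IsTranslator X Y V) (hb : branchSet X Y V = ∅) : V \ {1} ⊆ symm Y := by
  rintro v ⟨hv, hv1⟩
  obtain ⟨h1, -, -, hYV⟩ := (isTranslator_iff hX hY).1 hV
  obtain ⟨y, hy, h | ⟨h, z, hz, hzy⟩⟩ := hY.exists_link h1 hYV hv hv1
  · rw [eq_inv_of_mul_eq_one_left h]; exact inv_mem_symm hy.1
  · have := hV.three_le_valence hX hY hy.2 h hz ⟨inv_mem_symm hy.1, by simpa⟩ hzy
    rw [hb] at this
    exact absurd this (Set.notMem_empty _)

/-- Each edge of the `Y`-star has an end at 1, so its label is a vertex or the inverse of one; the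
nontrivial vertices also form the `X`-star. -/
lemma IsTranslator.symm_subset (hX : IsBasis X) (hY : IsBasis Y) {V : Set F}
    (hV : IsTranslator X Y V) (hb : branchSet X Y V = ∅) : symm Y ⊆ symm X := by
  have hV' := hV.inv hX hY
  have hb' : branchSet Y X V⁻¹ = ∅ := by rw [branchSet_inv hX hY, hb, Set.inv_empty]
  have hsub : ∀ v ∈ V, v ≠ 1 → v ∈ symm X := fun v hv hv1 => by
    rw [← inv_inv v]
    exact inv_mem_symm (hV'.sdiff_subset hY hX hb' ⟨by simpa, by simpa⟩)
  intro z hz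
  obtain ⟨u, hu, huz⟩ := hV.exists_right hX hY hz
  by_cases hu1 : u = 1
  · rw [hu1, one_mul] at huz
    exact hsub z huz (fun h => hY.one_notMem_symm (h ▸ hz))
  by_cases huz1 : u * z = 1
  · rw [eq_inv_of_mul_eq_one_right huz1]
    exact inv_mem_symm (hsub u hu hu1)
  have huY : u ∈ symm Y := hV.sdiff_subset hX hY hb ⟨hu, hu1⟩
  have := hV.three_le_valence hX hY hu hu1 (y := z) (z := u⁻¹) ⟨hz, huz⟩
    ⟨inv_mem_symm huY, by simpa using hV.one_mem⟩ (by
      rintro rfl; simp at huz1)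
  rw [hb] at this
  exact absurd this (Set.notMem_empty _)

lemma IsTranslator.symm_eq (hX : IsBasis X) (hY : IsBasis Y) {V : Set F}
    (hV : IsTranslator X Y V) (hb : branchSet X Y V = ∅) : symm X = symm Y :=
  ((hV.inv hX hY).symm_subset hY hX (by rw [branchSet_inv hX hY, hb, Set.inv_empty])).antisymm
    (hV.symm_subset hX hY hb)

/-- A vertex of valence three is joined by a `Y`-edge to `1` or another such vertex. -/
lemma IsTranslator.exists_branch_edge (hX : IsBasis X) (hY : IsBasis Y) {V : Set F}
    (hV : IsTranslator X Y V) {v : F} (hv : v ∈ branchSet X Y V) :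
    ∃ a ∈ symm Y, v * a ∈ V ∧ (v * a = 1 ∨ v * a ∈ branchSet X Y V) := by
  obtain ⟨h1, -, -, hYV⟩ := (isTranslator_iff hX hY).1 hV
  obtain ⟨y, hy, h⟩ := hY.exists_link h1 hYV hv.1.1 hv.1.2
  refine ⟨y, hy.1, hy.2, h.imp id ?_⟩
  rintro ⟨h, z, hz, hzy⟩
  exact hV.three_le_valence hX hY hy.2 h hz ⟨inv_mem_symm hy.1, by simpa using hv.1.1⟩ hzy

/-! ### Exchanging edges of the two trees -/

lemma IsBasis.mem_cut_flip (hX : IsBasis X) {d x s : F} (hx : x ∈ symm X) :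
    s ∈ cut X (x⁻¹ * d) x⁻¹ ↔ s ∉ cut X d x := by
  have h := hX.side_compl (g := d * s⁻¹) hx
  simp only [cut, Set.mem_ofPred_eq, mul_assoc]
  exact h.symm

/-- For each `Y`-edge of `V` there is an `X`-edge such that each of them joins the two parts into
which the tree of the other is divided. -/
lemma IsTranslator.exists_exchange (hX : IsBasis X) (hY : IsBasis Y) {V : Set F}
    (hV : IsTranslator X Y V) {v a : F} (hv : v ∈ V) (ha : a ∈ symm Y) (hva : v * a ∈ V) :
    ∃ d x, x ∈ symm X ∧ d ∈ V ∧ x⁻¹ * d ∈ V ∧ v ∉ cut X d x ∧ v * a ∈ cut X d x ∧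
      d⁻¹ ∉ cut Y v⁻¹ a ∧ d⁻¹ * x ∈ cut Y v⁻¹ a := by
  obtain ⟨-, -, hXV, -⟩ := (isTranslator_iff hX hY).1 hV
  -- Follow the `X`-geodesic from `v⁻¹` to `(v * a)⁻¹` until it first passes to the other side of
  -- the `Y`-edge. The `X`-step found there lies on the geodesic, hence separates its ends in the
  -- `X`-tree.
  have key : ∀ l m : List F, IsReducedSeq X (m ++ l) → v⁻¹ * (m ++ l).prod = (v * a)⁻¹ →
      v⁻¹ * m.prod ∉ cut Y v⁻¹ a → ∃ m' x l', IsReducedSeq X (m' ++ x :: l') ∧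
        v⁻¹ * (m' ++ x :: l').prod = (v * a)⁻¹ ∧
        v⁻¹ * m'.prod ∉ cut Y v⁻¹ a ∧ v⁻¹ * m'.prod * x ∈ cut Y v⁻¹ a := by
    intro l
    induction l with
    | nil =>
      intro m hm h1 h2
      rw [List.append_nil] at h1
      refine absurd ?_ h2
      rw [h1]
      simpa [cut] using hY.self_mem_side ha
    | cons x l ih =>
      intro m hm h1 h2
      by_cases h3 : v⁻¹ * m.prod * x ∈ cut Y v⁻¹ a
      · exact ⟨m, x, l, hm, h1, h2, h3⟩
      · exact ih (m ++ [x]) (by simpa using hm) (by simpa using h1)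
          (by simpa [mul_assoc] using h3)
  obtain ⟨l, hl, hlp⟩ := hX.exists_reduced (v * (v * a)⁻¹)
  obtain ⟨m, x, l', h1, h2, h3, h4⟩ := key l [] hl (by rw [List.nil_append, hlp]; group)
    (by simpa [cut] using hY.one_notMem_side)
  obtain ⟨hm, hxl, hj⟩ := isReducedSeq_append.1 h1
  have hmem : v⁻¹ * (m ++ x :: l').prod ∈ V⁻¹ := by rw [h2]; simpa
  have hm1 := hXV.append_mem (v := v⁻¹) (by simpa) h1 hmem
  have hm2 := hXV.append_mem (v := v⁻¹) (l := m ++ [x]) (m := l') (by simpa) (by simpa using h1)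
    (by simpa using hmem)
  refine ⟨(v⁻¹ * m.prod)⁻¹, x, hxl.mem_symm, hm1, ?_, ?_, ?_, by simpa using h3, by simpa using h4⟩
  · simpa [mul_assoc] using hm2
  · have : (v⁻¹ * m.prod)⁻¹ * v⁻¹ = (m.map (·⁻¹)).reverse.prod := by
      rw [prod_map_inv_reverse]; group
    simp only [cut, Set.mem_ofPred_eq, this]
    rw [hX.mem_side_of_reduced hm.inv, List.head?_reverse, List.getLast?_map,
      Option.map_eq_some_iff]
    rintro ⟨t, ht, rfl⟩
    exact hj t ht _ rfl rfl
  · have : (v⁻¹ * m.prod)⁻¹ * (v * a)⁻¹ = (x :: l').prod := by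
      rw [← h2, List.prod_append]; group
    simp only [cut, Set.mem_ofPred_eq, this]
    exact hX.cons_mem_side hxl

/-- In a translator with only one `Y`-edge of each label, surgery is possible along each `X`-edge
that separates the ends of a given `Y`-edge. -/
lemma IsTranslator.exists_surgery {V : Set F} (hX : IsBasis X) (hV : IsTranslator X Y V)
    (huniq : ∀ y ∈ symm Y, ∀ u ∈ V, u * y ∈ V → ∀ w ∈ V, w * y ∈ V → u = w) {d x v a : F}
    (hx : x ∈ symm X) (hd : d ∈ V) (hxd : x⁻¹ * d ∈ V) (ha : a ∈ symm Y) (hv : v ∈ V)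
    (hva : v * a ∈ V) (hsep : v ∈ cut X d x ↔ v * a ∉ cut X d x) :
    ∃ e z u b, Surgery X Y V e z b ∧ OnLeft e z = OnLeft d x ∧ u ∈ V ∧ u * b ∈ V ∧
      u ∈ cut X e z ∧ u * b ∉ cut X e z ∧ ((u = v ∧ b = a) ∨ (u = v * a ∧ b = a⁻¹)) ∧
      ∀ p t, OnRight v a p t → Crosses X e z b p t := by
  wlog h1 : 1 ∉ cut X d x generalizing d x
  · have h2 := this (d := x⁻¹ * d) (x := x⁻¹) (inv_mem_symm hx) hxd (by simpa)
      (by rw [hX.mem_cut_flip hx, hX.mem_cut_flip hx]; tauto)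
      ((hX.one_notMem_cut_or hx).resolve_left h1)
    rwa [onLeft_flip] at h2
  -- With one edge per label, the two side conditions of a surgery compare an edge only with itself.
  have hsurg : ∀ u b, b ∈ symm Y → u ∈ V → u * b ∈ V → u ∈ cut X d x → Surgery X Y V d x b :=
    fun u b hb hu hub huc => ⟨hV, hd, hx, hxd, h1, hb,
      fun y hy _ _ p hp hpy q hq hqy hpc => huniq y hy p hp hpy q hq hqy ▸ hpc,
      fun w hw hwb _ => huniq b hb u hu hub w hw hwb ▸ huc⟩
  by_cases hvc : v ∈ cut X d x
  · refine ⟨d, x, v, a, hsurg v a ha hv hva hvc, rfl, hv, hva, hvc, hsep.1 hvc,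
      Or.inl ⟨rfl, rfl⟩, ?_⟩
    rintro p t (⟨rfl, rfl⟩ | ⟨rfl, rfl⟩)
    · exact Or.inl ⟨rfl, hvc, hsep.1 hvc⟩
    · exact Or.inr ⟨rfl, hsep.1 hvc, by rwa [mul_inv_cancel_right]⟩
  · have hvac : v * a ∈ cut X d x := by tauto
    have h2 : v * a * a⁻¹ = v := by group
    refine ⟨d, x, v * a, a⁻¹, hsurg _ _ (inv_mem_symm ha) hva (by rwa [h2]) hvac, rfl, hva,
      by rwa [h2], hvac, by rwa [h2], Or.inr ⟨rfl, rfl⟩, ?_⟩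
    rintro p t (⟨rfl, rfl⟩ | ⟨rfl, rfl⟩)
    · exact Or.inr ⟨by rw [inv_inv], hvc, by rwa [inv_inv]⟩
    · exact Or.inl ⟨rfl, hvac, by rwa [h2]⟩

lemma exists_of_mem_symm_twist {e : F → F} {b z : F} (h : z ∈ symm (twist e b '' Y)) :
    ∃ y ∈ symm Y, z = twist e b y := by
  rcases h with ⟨y, hy, rfl⟩ | ⟨y, hy, h⟩
  · exact ⟨y, Or.inl hy, rfl⟩
  · exact ⟨y⁻¹, Or.inr (by simpa), by rw [twist_inv, h, inv_inv]⟩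

namespace Surgery
variable {V : Set F} {e x b : F}

lemma twist_eq (H : Surgery X Y V e x b) {t y : F} (hy : y ∈ symm Y) (hyb : y ≠ b)
    (hyb' : y ≠ b⁻¹) (ht : t ∈ V) (hty : t * y ∈ V) :
    glue X e x b t * twist (factor X V e x b) b y = glue X e x b (t * y) := by
  rw [twist, if_neg (by tauto), H.factor_eq_shift hy hyb hyb' ht hty,
    H.factor_eq_shift (inv_mem_symm hy) (fun h => hyb' (by rw [← h, inv_inv]))
      (fun h => hyb (inv_injective h)) hty (by simpa), glue, glue]
  group

/-- Gluing loses at least one vertex and one is added, while no translator is smaller than `1 +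
X.encard`. So equality holds throughout: the added vertex is new, and only `u` and `u * b` are
identified. -/
lemma encard_insert_glue (H : Surgery X Y V e x b) (hX : IsBasis X) (hY : IsBasis Y)
    (hfin : X.Finite) (hcard : V.encard = 1 + X.encard) {u : F} (hu : u ∈ V) (hub : u * b ∈ V)
    (huc : u ∈ cut X e x) (hubc : u * b ∉ cut X e x) :
    (insert (x⁻¹ * e) (glue X e x b '' V)).encard = 1 + X.encard ∧
      x⁻¹ * e ∉ glue X e x b '' V ∧ Set.InjOn (glue X e x b) (V \ {u}) := by
  have hVfin : V.Finite := by
    rw [← Set.encard_lt_top_iff, hcard]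
    exact ENat.add_lt_top.2 ⟨ENat.one_lt_top, hfin.encard_lt_top⟩
  have hT := H.isTranslator_insert_glue hX hY hu hub huc hubc
  have h1 := (hT.inv hX (H.isBasis hY)).encard_le (H.isBasis hY) hX
  have h2 := encard_sdiff_one (hT.inv hX (H.isBasis hY)).one_mem
  rw [Set.encard_inv] at h2
  have h3 : 1 + X.encard ≤ (insert (x⁻¹ * e) (glue X e x b '' V)).encard := by
    rw [← h2, add_comm]; gcongr
  have h4 := H.encard_glue_lt hY hVfin hu hub huc hubc
  have h5 := Set.encard_insert_le (glue X e x b '' V) (x⁻¹ * e)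
  have h6 : (glue X e x b '' V).encard + 1 ≤ V.encard := Order.add_one_le_of_lt h4
  have h7 : x⁻¹ * e ∉ glue X e x b '' V := by
    intro h
    rw [Set.insert_eq_of_mem h, ← hcard] at h3
    exact absurd h4 (not_lt.2 h3)
  refine ⟨le_antisymm (h5.trans (h6.trans hcard.le)) h3, h7, ?_⟩
  have h8 : glue X e x b '' V = glue X e x b '' (V \ {u}) := by
    refine Set.Subset.antisymm ?_ (Set.image_mono Set.sdiff_subset)
    rintro _ ⟨w, hw, rfl⟩
    by_cases hwu : w = u
    · subst hwu
      refine ⟨w * b, ⟨hub, fun h => ?_⟩, (glue_eq hubc huc).symm⟩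
      have : b = 1 := by simpa using h
      exact hY.one_notMem_symm (this ▸ H.letter_right)
    · exact ⟨w, ⟨hw, hwu⟩, rfl⟩
  have h9 : (glue X e x b '' V).encard + 1 = V.encard := by
    refine le_antisymm h6 ?_
    rw [hcard]
    exact h3.trans h5
  have hf : (V \ {u}).Finite := hVfin.subset Set.sdiff_subset
  refine Set.injOn_of_ncard_image_eq ?_ hf
  rw [← h8, Set.ncard, Set.ncard]
  congr 1
  rw [← Set.encard_sdiff_singleton_add_one hu] at h9
  exact ENat.add_left_injective_of_ne_top (by simp) h9

/-- Apart from the merged vertex, which was already a branch vertex or 1, no old vertex gains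
valence, and the added vertex has valence at most two. -/
lemma mem_branchSet (H : Surgery X Y V e x b) (hX : IsBasis X) (hY : IsBasis Y)
    (hfin : X.Finite) (hcard : V.encard = 1 + X.encard) {u : F} (hu : u ∈ V) (hub : u * b ∈ V)
    (huc : u ∈ cut X e x) (hubc : u * b ∉ cut X e x)
    (hbr : u * b = 1 ∨ u * b ∈ branchSet X Y V) :
    branchSet X (surgeryBasis X Y V e x b) (insert (x⁻¹ * e) (glue X e x b '' V)) ⊆
      glue X e x b '' (branchSet X Y V \ {u}) := by
  obtain ⟨hcard', hnew, hinj⟩ := H.encard_insert_glue hX hY hfin hcard hu hub huc hubc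
  have hT := H.isTranslator_insert_glue hX hY hu hub huc hubc
  have hY' := H.isBasis hY
  set V' := insert (x⁻¹ * e) (glue X e x b '' V) with hV'
  set Y' := surgeryBasis X Y V e x b
  have hfin' : Y'.Finite := by
    rw [← Set.encard_lt_top_iff, ← hX.encard_eq hY']; exact hfin.encard_lt_top
  have hcardT : (V' \ {1}).encard = X.encard := by
    have h1 := encard_sdiff_one hT.one_mem
    rw [hcard', add_comm 1] at h1
    exact ENat.add_left_injective_of_ne_top (by simp) h1
  -- The new translator is again as small as possible, so exhibiting one edge of each label
  -- determines all the edges.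
  have huY : ∀ z ∈ symm Y', ∀ p ∈ V', p * z ∈ V' → ∀ q ∈ V', q * z ∈ V' → p = q :=
    fun z hz p hp hpz q hq hqz => hT.eq_of_encard hX hY' hfin'
      (by rw [hcardT, hX.encard_eq hY']) hz hp hpz hq hqz
  have huX : ∀ z ∈ symm X, ∀ p ∈ V', z⁻¹ * p ∈ V' → ∀ q ∈ V', z⁻¹ * q ∈ V' → p = q := by
    intro z hz p hp hpz q hq hqz
    have h1 : (V'⁻¹ \ {1}).encard = X.encard := by
      rw [← hcardT, ← Set.encard_inv (V' \ {1})]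
      congr 1; ext s; simp
    exact inv_injective ((hT.inv hX hY').eq_of_encard hY' hX hfin h1 hz
      (by simpa using hp) (by simpa using hpz) (by simpa using hq) (by simpa using hqz))
  have hgl : ∀ t ∈ V, glue X e x b t ∈ V' := fun t ht => Or.inr ⟨t, ht, rfl⟩
  have hnewV : x⁻¹ * e ∈ V' := Set.mem_insert _ _
  have heg : glue X e x b e = e := glue_of_notMem hX.left_notMem_cut
  have heV : e ∈ V' := heg ▸ hgl e H.left_mem
  have hneg : glue X e x b (x⁻¹ * e) = x⁻¹ * e * b :=
    glue_of_mem (hX.right_mem_cut H.letter_left)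
  have hnb : x⁻¹ * e * b ∈ V' := hneg ▸ hgl _ H.right_mem
  have hb1 : b ≠ 1 := fun h => hY.one_notMem_symm (h ▸ H.letter_right)
  have hx1 : x ≠ 1 := fun h => hX.one_notMem_symm (h ▸ H.letter_left)
  have edgeX : ∀ z ∈ symm X, ∀ p ∈ V', z⁻¹ * p ∈ V' →
      (z ≠ x⁻¹ ∧ ∃ t ∈ V, z⁻¹ * t ∈ V ∧ p = glue X e x b t) ∨ (z = x⁻¹ ∧ p = x⁻¹ * e) := by
    intro z hz p hp hzp
    by_cases h1 : z = x⁻¹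
    · exact Or.inr ⟨h1, huX z hz p hp hzp _ hnewV (by rw [h1]; simpa)⟩
    by_cases h2 : z = x
    · exact Or.inl ⟨h1, e, H.left_mem, h2 ▸ H.right_mem,
        by rw [heg]; exact huX z hz p hp hzp e heV (h2 ▸ hnewV)⟩
    obtain ⟨t, ht, hzt⟩ := H.translator.exists_left hX hY hz
    refine Or.inl ⟨h1, t, ht, hzt, huX z hz p hp hzp _ (hgl t ht) ?_⟩
    have h3 := hX.cut_iff (u := t) (v := e) (x := x) hz (fun h => h2 h.2) (fun h => h1 h.2)
    have h4 : z⁻¹ * glue X e x b t = glue X e x b (z⁻¹ * t) := by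
      by_cases h5 : t ∈ cut X e x
      · rw [glue_of_mem h5, glue_of_mem (h3.1 h5), mul_assoc]
      · rw [glue_of_notMem h5, glue_of_notMem (mt h3.2 h5)]
    rw [h4]; exact hgl _ hzt
  have edgeY : ∀ z ∈ symm Y', ∀ p ∈ V', p * z ∈ V' →
      (∃ y ∈ symm Y, z = twist (factor X V e x b) b y ∧ ∃ t ∈ V, t * y ∈ V ∧
        p = glue X e x b t) ∨ (z = b ∧ p = x⁻¹ * e) ∨ (z = b⁻¹ ∧ p = x⁻¹ * e * b) := by
    intro z hz p hp hpz
    obtain ⟨y, hy, hzy⟩ := exists_of_mem_symm_twist hz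
    by_cases h1 : y = b
    · have h2 : z = b := by rw [hzy, h1, twist_self]
      exact Or.inr (Or.inl ⟨h2, huY z hz p hp hpz _ hnewV (by rwa [h2])⟩)
    by_cases h1' : y = b⁻¹
    · have h2 : z = b⁻¹ := by rw [hzy, h1', twist_inv, twist_self]
      exact Or.inr (Or.inr ⟨h2, huY z hz p hp hpz _ hnb (by rw [h2]; simpa)⟩)
    obtain ⟨t, ht, hty⟩ := H.translator.exists_right hX hY hy
    refine Or.inl ⟨y, hy, hzy, t, ht, hty, huY z hz p hp hpz _ (hgl t ht) ?_⟩
    rw [hzy, H.twist_eq hy h1 h1' ht hty]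
    exact hgl _ hty
  rintro p ⟨⟨hp, hp1⟩, hval⟩
  rw [valence_eq hX hY'] at hval
  have hp' : p ≠ x⁻¹ * e := by
    intro hpe
    have hX1 : links X V'⁻¹ p⁻¹ ⊆ {x⁻¹} := by
      rintro z ⟨hz, hzp⟩
      rcases edgeX z hz p hp (by simpa using hzp) with ⟨-, t, ht, -, h⟩ | ⟨h, -⟩
      · exact absurd ⟨t, ht, by rw [← h, hpe]⟩ hnew
      · exact h
    have hY1 : links Y' V' p ⊆ {b} := by
      rintro z ⟨hz, hzp⟩
      rcases edgeY z hz p hp hzp with ⟨y, -, -, t, ht, -, h⟩ | ⟨h, -⟩ | ⟨-, h⟩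
      · exact absurd ⟨t, ht, by rw [← h, hpe]⟩ hnew
      · exact h
      · rw [hpe] at h
        exact absurd (by simpa using h) hb1
    have h1 := Set.encard_le_encard hX1
    have h2 := Set.encard_le_encard hY1
    rw [Set.encard_singleton] at h1 h2
    have h3 := hval.trans (add_le_add h1 h2)
    norm_num at h3
  obtain ⟨w, hw, hwu, rfl⟩ : ∃ w ∈ V, w ≠ u ∧ glue X e x b w = p := by
    rcases hp with hp | ⟨w, hw, hwp⟩
    · exact absurd hp hp'
    by_cases hwu : w = u
    · subst hwu
      refine ⟨w * b, hub, by simpa using hb1, ?_⟩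
      rw [← hwp, glue_eq hubc huc]
    · exact ⟨w, hw, hwu, hwp⟩
  have hw1 : w ≠ 1 := by
    rintro rfl
    exact hp1 (glue_of_notMem H.one_notMem)
  refine ⟨w, ⟨?_, hwu⟩, rfl⟩
  by_cases hwub : w = u * b
  · rw [hwub] at hw1 ⊢
    exact hbr.resolve_left hw1
  have hinj' : ∀ t ∈ V, glue X e x b w = glue X e x b t → w = t := by
    intro t ht h
    by_cases htu : t = u
    · subst htu
      rw [glue_eq hubc huc] at h
      exact absurd (hinj ⟨hw, hwu⟩ ⟨hub, by simpa using hb1⟩ h) hwub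
    · exact hinj ⟨hw, hwu⟩ ⟨ht, htu⟩ h
  refine ⟨⟨hw, hw1⟩, hval.trans ?_⟩
  rw [valence_eq hX hY]
  have hX1 : links X V'⁻¹ (glue X e x b w)⁻¹ ⊆ links X V⁻¹ w⁻¹ \ {x⁻¹} := by
    rintro z ⟨hz, hzp⟩
    rcases edgeX z hz _ hp (by simpa using hzp) with ⟨hzx, t, ht, hzt, h⟩ | ⟨-, h⟩
    · rw [hinj' t ht h]
      exact ⟨⟨hz, by simpa using hzt⟩, hzx⟩
    · exact absurd h hp'
  have hY1 : links Y' V' (glue X e x b w) ⊆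
      twist (factor X V e x b) b '' links Y V w ∪ {z | z = b⁻¹ ∧ w = x⁻¹ * e} := by
    rintro z ⟨hz, hzp⟩
    rcases edgeY z hz _ hp hzp with ⟨y, hy, hzy, t, ht, hty, h⟩ | ⟨-, h⟩ | ⟨hzb, h⟩
    · refine Or.inl ⟨y, ⟨hy, ?_⟩, hzy.symm⟩
      rwa [hinj' t ht h]
    · exact absurd h hp'
    · rw [← hneg] at h
      exact Or.inr ⟨hzb, hinj' _ H.right_mem h⟩
  have h1 := Set.encard_le_encard hX1
  have h2 := (Set.encard_le_encard hY1).trans (Set.encard_union_le _ _)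
  have h3 := Set.encard_image_le (twist (factor X V e x b) b) (links Y V w)
  -- The far end of the cut edge trades its lost `X`-link for a `Y`-link to the added vertex.
  by_cases hwe : w = x⁻¹ * e
  · have h4 : {z | z = b⁻¹ ∧ w = x⁻¹ * e} = {b⁻¹} := by ext z; simp [hwe]
    have h5 : x⁻¹ ∈ links X V⁻¹ w⁻¹ := ⟨inv_mem_symm H.letter_left, by
      simpa [hwe] using H.left_mem⟩
    rw [h4, Set.encard_singleton] at h2
    calc _ ≤ (links X V⁻¹ w⁻¹ \ {x⁻¹}).encard + ((links Y V w).encard + 1) :=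
          add_le_add h1 (h2.trans (by gcongr))
      _ = (links X V⁻¹ w⁻¹ \ {x⁻¹}).encard + 1 + (links Y V w).encard := by ring
      _ = _ := by rw [Set.encard_sdiff_singleton_add_one h5]
  · have h4 : {z | z = b⁻¹ ∧ w = x⁻¹ * e} = ∅ := by ext z; simp [hwe]
    rw [h4, Set.encard_empty, add_zero] at h2
    exact add_le_add (h1.trans (Set.encard_le_encard Set.sdiff_subset)) (h2.trans h3)

end Surgery

/-- If a translator of the least possible cardinality has a vertex of valence three, then the second
basis has a Whitehead transform of the same total length with fewer such vertices. -/
lemma IsTranslator.exists_fewer_branches (hX : IsBasis X) (hY : IsBasis Y) {V : Set F}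
    (hV : IsTranslator X Y V) (hfin : X.Finite) (hcard : V.encard = 1 + X.encard)
    {R : Finset (Word F)} (hXmin : IsLocalMin R X) (hYmin : IsLocalMin R Y)
    (hne : (branchSet X Y V).Nonempty) :
    ∃ Y' V', IsBasis Y' ∧ IsWhiteheadTransform Y Y' ∧ h R Y' = h R Y ∧ IsTranslator X Y' V' ∧
      V'.encard = 1 + X.encard ∧ (branchSet X Y' V').encard < (branchSet X Y V).encard := by
  obtain ⟨v, hv⟩ := hne
  obtain ⟨a, ha, hva, hab⟩ := hV.exists_branch_edge hX hY hv
  obtain ⟨d, x, hx, hd, hxd, h1, h2, h3, h4⟩ := hV.exists_exchange hX hY hv.1.1 ha hva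
  have hV' := hV.inv hX hY
  have hYfin : Y.Finite := by
    rw [← Set.encard_lt_top_iff, ← hX.encard_eq hY]; exact hfin.encard_lt_top
  have hcardV : (V \ {1}).encard = X.encard := by
    have h1 := encard_sdiff_one hV.one_mem
    rw [hcard, add_comm 1] at h1
    exact ENat.add_left_injective_of_ne_top (by simp) h1
  have hcardV' : (V⁻¹ \ {1}).encard = X.encard := by
    rw [← hcardV, ← Set.encard_inv (V \ {1})]
    congr 1; ext s; simp
  choose base walk hwalk using fun r => hV.exists_realizes hX hY r
  -- The dual surgery cuts the `Y`-edge; the `X`-edge crosses that cut, so local minimality of `X`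
  -- makes it no heavier than the `Y`-edge.
  obtain ⟨e', z', u', b', H', hD', -, -, -, -, -, hcross'⟩ := hV'.exists_surgery hY
    (fun y hy u hu huy w hw hwy => hV'.eq_of_encard hY hX hfin hcardV' hy hu huy hw hwy)
    ha (d := v⁻¹) (v := d⁻¹) (a := x) (by simpa using hv.1.1) (by simpa using hva) hx
    (by simpa using hd) (by simpa using hxd) (by tauto)
  have h5 := H'.weight_le hY hX (R := R) (fun r => (hwalk r).swap) hXmin
  rw [hD', weight_swap_onLeft] at h5
  have h6 := (weight_mono (R := R) hcross').trans h5
  rw [weight_swap_onRight, inv_inv] at h6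
  obtain ⟨e, z, u, b, H, hD, hu, hub, huc, hubc, hor, hcross⟩ := hV.exists_surgery hX
    (fun y hy u hu huy w hw hwy => hV.eq_of_encard hX hY hYfin
      (by rw [hcardV, hX.encard_eq hY]) hy hu huy hw hwy)
    hx hd hxd ha hv.1.1 hva (by tauto)
  have h7 := H.h_eq hX hY hwalk hYmin (by rw [hD]; exact h6.trans (weight_mono hcross))
  have hu1 : u ≠ 1 := by rintro rfl; exact H.one_notMem huc
  obtain ⟨hubr, hbr⟩ : u ∈ branchSet X Y V ∧ (u * b = 1 ∨ u * b ∈ branchSet X Y V) := by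
    rcases hor with ⟨rfl, rfl⟩ | ⟨rfl, rfl⟩
    · exact ⟨hv, hab⟩
    · exact ⟨hab.resolve_left hu1, Or.inr (by simpa using hv)⟩
  refine ⟨_, _, H.isBasis hY, H.isWhiteheadTransform, h7,
    H.isTranslator_insert_glue hX hY hu hub huc hubc,
    (H.encard_insert_glue hX hY hfin hcard hu hub huc hubc).1, ?_⟩
  have hVfin : V.Finite := by
    rw [← Set.encard_lt_top_iff, hcard]
    exact ENat.add_lt_top.2 ⟨ENat.one_lt_top, hfin.encard_lt_top⟩
  have hbfin : (branchSet X Y V).Finite := hVfin.subset fun w hw => hw.1.1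
  refine ((Set.encard_le_encard (H.mem_branchSet hX hY hfin hcard hu hub huc hubc hbr)).trans
    (Set.encard_image_le _ _)).trans_lt ?_
  exact (hbfin.subset Set.sdiff_subset).encard_lt_encard
    ⟨Set.sdiff_subset, fun h => (h hubr).2 rfl⟩

/-! ### The translator complexity -/

/-- The minimum in the definition of `kappa` is attained, and it is finite. -/
lemma exists_kappa_eq (hX : IsBasis X) (hY : IsBasis Y) (hfin : Y.Finite) :
    ∃ V, IsTranslator X Y V ∧ V.Finite ∧ kappa X Y = (V \ {1}).encard := by
  obtain ⟨W, hW, hWfin⟩ := exists_finite_translator hX hY hfin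
  obtain ⟨V, hV, hmin⟩ := exists_minimalFor_of_wellFoundedLT (IsTranslator X Y)
    (fun V => (V \ {1}).encard) ⟨W, hW⟩
  have hmin' : ∀ U, IsTranslator X Y U → (V \ {1}).encard ≤ (U \ {1}).encard := fun U hU =>
    (le_total (V \ {1}).encard (U \ {1}).encard).elim id fun h => hmin hU h
  refine ⟨V, hV, ?_, le_antisymm (iInf₂_le V hV) (le_iInf₂ hmin')⟩
  have h1 : (V \ {1}).Finite := by
    rw [← Set.encard_lt_top_iff]
    exact (hmin' W hW).trans_lt (hWfin.subset Set.sdiff_subset).encard_lt_top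
  rw [← Set.encard_lt_top_iff, ← encard_sdiff_one hV.one_mem]
  exact ENat.add_lt_top.2 ⟨h1.encard_lt_top, ENat.one_lt_top⟩

lemma IsTranslator.encard_left_le (hX : IsBasis X) (hY : IsBasis Y) {V : Set F}
    (hV : IsTranslator X Y V) : X.encard ≤ (V \ {1}).encard := by
  rw [hX.encard_eq hY]; exact hV.encard_le hX hY

lemma exists_small_translator (hX : IsBasis X) (hY : IsBasis Y) (hfin : Y.Finite)
    (hk : ¬ X.encard < kappa X Y) : ∃ V, IsTranslator X Y V ∧ V.encard = 1 + X.encard := by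
  obtain ⟨V, hV, -, hVk⟩ := exists_kappa_eq hX hY hfin
  refine ⟨V, hV, ?_⟩
  rw [← encard_sdiff_one hV.one_mem, add_comm]
  congr 1
  exact le_antisymm (hVk ▸ not_lt.1 hk) (hV.encard_left_le hX hY)

lemma IsTranslator.d_le_branch {V : Set F}
    (hV : IsTranslator X Y V) (hcard : V.encard = 1 + X.encard) :
    d X Y ≤ (branchSet X Y V).encard := by
  have h1 : ¬ X.encard < kappa X Y := by
    rw [not_lt]
    refine (iInf₂_le V hV).trans ?_
    have h1 := encard_sdiff_one hV.one_mem
    rw [hcard, add_comm 1] at h1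
    exact (ENat.add_left_injective_of_ne_top (by simp) h1).le
  rw [d, if_neg h1]
  exact (iInf₂_le V hV).trans (iInf_le _ hcard)

/-- Both cases in the definition of `d` obey this bound, so it applies to a new basis without
knowing which case it falls into. -/
lemma IsTranslator.d_le (hX : IsBasis X) (hY : IsBasis Y) {V : Set F} (hfin : Y.Finite)
    (hV : IsTranslator X Y V) : d X Y ≤ (V \ {1}).encard := by
  by_cases hk : X.encard < kappa X Y
  · rw [d, if_pos hk]; exact iInf₂_le V hV
  · obtain ⟨W, hW, hcard⟩ := exists_small_translator hX hY hfin hk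
    rw [d, if_neg hk]
    refine ((iInf₂_le W hW).trans (iInf_le _ hcard)).trans ?_
    refine (Set.encard_le_encard (t := W \ {1}) fun v hv => hv.1).trans ?_
    refine le_trans (le_of_eq ?_) (hV.encard_left_le hX hY)
    have h1 := encard_sdiff_one hW.one_mem
    rw [hcard, add_comm 1] at h1
    exact ENat.add_left_injective_of_ne_top (by simp) h1

lemma exists_d_eq_branch (hX : IsBasis X) (hY : IsBasis Y) (hfin : Y.Finite)
    (hk : ¬ X.encard < kappa X Y) : ∃ V, IsTranslator X Y V ∧ V.encard = 1 + X.encard ∧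
      d X Y = (branchSet X Y V).encard := by
  obtain ⟨V, ⟨hV, hcard⟩, hmin⟩ := exists_minimalFor_of_wellFoundedLT
    (fun V => IsTranslator X Y V ∧ V.encard = 1 + X.encard)
    (fun V => (branchSet X Y V).encard) (exists_small_translator hX hY hfin hk)
  refine ⟨V, hV, hcard, ?_⟩
  rw [d, if_neg hk]
  refine le_antisymm ((iInf₂_le V hV).trans (iInf_le _ hcard)) ?_
  exact le_iInf₂ fun U hU => le_iInf fun hUc =>
    (le_total (branchSet X Y V).encard (branchSet X Y U).encard).elim id fun h => hmin ⟨hU, hUc⟩ h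

end WhiteheadGraph

end

/-! ### Whitehead's theorem -/

open WhiteheadGraph in
theorem theorem3p2 {F : Type*} [Group F] [IsFreeGroup F] [Group.FG F]
    (R : Finset (Word F)) (X Y : Set F) (hX : IsBasis X) (hY : IsBasis Y)
    (hXmin : IsLocalMin R X) (hYmin : IsLocalMin R Y) :
    d X Y < ⊤ ∧
      (symm X = symm Y ∨
        ∃ Y' : Set F, IsBasis Y' ∧ IsWhiteheadTransform Y Y' ∧
          h R Y' = h R Y ∧ d X Y' < d X Y) := by
  obtain ⟨V, hV, hVfin, hVk⟩ := exists_kappa_eq hX hY hY.finite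
  refine ⟨(hV.d_le hX hY hY.finite).trans_lt (hVfin.subset Set.sdiff_subset).encard_lt_top, ?_⟩
  by_cases hk : X.encard < kappa X Y
  · right
    -- With at most one edge per label, `kappa` would not exceed the rank.
    obtain ⟨y, hy, u, hu, huy, w, hw, hwy, huw⟩ : ∃ y ∈ symm Y, ∃ u ∈ V, u * y ∈ V ∧
        ∃ w ∈ V, w * y ∈ V ∧ u ≠ w := by
      by_contra! hcon
      have h1 := hV.encard_le_of_unique hX hY hcon
      rw [← hVk, ← hX.encard_eq hY] at h1
      exact absurd hk (not_lt.2 h1)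
    obtain ⟨Y', V', hY', hW, hh, hV', hlt⟩ :=
      hV.exists_smaller hX hY hVfin hXmin hYmin hy hu huy hw hwy huw
    refine ⟨Y', hY', hW, hh, (hV'.d_le hX hY' hY'.finite).trans_lt ?_⟩
    rw [d, if_pos hk, hVk]
    rw [← encard_sdiff_one hV'.one_mem, ← encard_sdiff_one hV.one_mem] at hlt
    exact lt_of_add_lt_add_right hlt
  · obtain ⟨W, hW, hcard, hd⟩ := exists_d_eq_branch hX hY hY.finite hk
    rcases (branchSet X Y W).eq_empty_or_nonempty with hb | hb
    · exact Or.inl (hW.symm_eq hX hY hb)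
    · obtain ⟨Y', V', hY', hWT, hh, hV', hcard', hlt⟩ :=
        hW.exists_fewer_branches hX hY hX.finite hcard hXmin hYmin hb
      exact Or.inr ⟨Y', hY', hWT, hh, by
        rw [hd]; exact (hV'.d_le_branch hcard').trans_lt hlt⟩
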